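/- Let $G$ be a meromorphic function on $\mathbb C$ (a retarded thermal correlator of a Hermitian operator) with only simple poles, holomorphic on $\{\operatorname{Im}\omega\ge 0\}$, and satisfying $\overline{G(\omega)}=G(-\bar\omega)$. Put $\rho(\omega)=\frac{G(\omega)-G(-\omega)}{2i}$, and let $\beta,\mu>0$, $\Delta\in\mathbb R$, $d\in\mathbb N$. Suppose that the poles of $G$ are arranged without repetition into $M$ sequences (branches) $\omega^+_{m,j}$, $m=1,2,\dots$, $j=1,\dots,M$, that the thermal product formula $$\rho(\omega)=\frac{\mu\,\sinh(\beta\omega/2)}{\prod_{j=1}^{M}\prod_{m\ge1}\bigl[1-(\omega/\omega^+_{m,j})^2\bigr]}$$ holds with a convergent product at every $\omega$ such that neither $\omega$ nor $-\omega$ is a pole of $G$, and that, for some real constant $C\neq0$, $\rho(\omega)/\omega^{2\Delta-d}\to C$ as $\omega\to+\infty$ along the real axis. (i) If there are complex numbers $d_j^+\neq0$ and $\xi_j^+$ and some $\epsilon>0$ such that $\omega^+_{m,j}=d_j^+(m+\xi_j^+)+O(m^{-\epsilon})$ as $m\to\infty$ for every $j$, then $$-i\sum_{j=1}^M\frac1{d_j^+}=\frac{\beta}{2\pi},\qquad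 \sum_{j=1}^M\bigl(1+2\xi_j^+\bigr)=2\Delta-d .$$ (ii) If, more generally, there are real numbers $\alpha_j\ge1$ and complex numbers $d_j^+\ne0$ such that $\omega^+_{m,j}/m^{\alpha_j}\to d_j^+$ as $m\to\infty$ for every $j$, then $$-i\sum_{j:\ \alpha_j=1}\frac1{d_j^+}=\frac{\beta}{2\pi}.$$ -/

import Mathlib

open Filter Asymptotics

/-- The spectrum of `G`: the set of its poles. -/
def spectrumPoles (G : ℂ → ℂ) : Set ℂ := {z | meromorphicOrderAt G z < 0}

/-- Analytic properties of a meromorphic retarded correlator of a Hermitian operator, as a function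
of complex frequency. The values of `G` at its poles carry no information; off the poles `G` is
analytic (no removable singularities). -/
structure IsRetardedCorrelator (G : ℂ → ℂ) : Prop where
  meromorphicAt : ∀ z, MeromorphicAt G z
  analyticAt : ∀ z, z ∉ spectrumPoles G → AnalyticAt ℂ G z
  simple : ∀ z ∈ spectrumPoles G, meromorphicOrderAt G z = -1
  retarded : ∀ z : ℂ, 0 ≤ z.im → AnalyticAt ℂ G z
  hermitian : ∀ z, z ∉ spectrumPoles G →
    (starRingEnd ℂ) (G z) = G (-(starRingEnd ℂ) z)

/-- The spectral density `ρ(ω) = (G(ω) - G(-ω)) / (2i)`. -/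
noncomputable def spectralDensity (G : ℂ → ℂ) (z : ℂ) : ℂ := (G z - G (-z)) / (2 * Complex.I)

/-- The family `w` lists every pole of `G` exactly once. -/
def EnumeratesSpectrum {ι : Type*} (G : ℂ → ℂ) (w : ι → ℂ) : Prop :=
  Function.Injective w ∧ Set.range w = spectrumPoles G

/-- The thermal product formula
`ρ(ω) = μ sinh(βω/2) / ∏ₙ (1 - (ω/ωₙ)²)`, with a convergent product, at every `ω` which is not a
pole of `ρ`. -/
def ThermalProductFormula {ι : Type*} (β μ : ℝ) (G : ℂ → ℂ) (w : ι → ℂ) : Prop :=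
  ∀ z : ℂ, z ∉ spectrumPoles G → -z ∉ spectrumPoles G →
    Multipliable (fun n => 1 - (z / w n) ^ 2) ∧
    spectralDensity G z = μ * Complex.sinh (β * z / 2) / ∏' n, (1 - (z / w n) ^ 2)

/-- `ρ(ω) ∼ ω ^ a` as `ω → +∞` along the real axis, up to a non-zero constant factor. -/
def SpectralDensityScales (G : ℂ → ℂ) (a : ℝ) : Prop :=
  ∃ C : ℝ, C ≠ 0 ∧
    (fun x : ℝ => spectralDensity G (x : ℂ)) ~[atTop] (fun x : ℝ => ((C * x ^ a : ℝ) : ℂ))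

/-- Generalised Christmas tree: `ω_{m,j} = δ_j (m + ξ_j) + O(m ^ (-ε))` for `m = 1, 2, …`, with some
`ε > 0`; the spacings `δ_j` do not vanish. -/
def IsChristmasTree {M : ℕ} (w : Fin M × ℕ+ → ℂ) (δ ξ : Fin M → ℂ) : Prop :=
  (∀ j, δ j ≠ 0) ∧ ∃ ε : ℝ, 0 < ε ∧ ∀ j,
    (fun m : ℕ+ => w (j, m) - δ j * ((m : ℂ) + ξ j)) =O[atTop] (fun m : ℕ+ => (m : ℝ) ^ (-ε))

/-- Branches with general scaling: `ω_{m,j} ∼ δ_j m ^ α_j` as `m → ∞`, with `δ_j ≠ 0`. -/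
def IsScalingTree {M : ℕ} (w : Fin M × ℕ+ → ℂ) (α : Fin M → ℝ) (δ : Fin M → ℂ) : Prop :=
  ∀ j, δ j ≠ 0 ∧
    (fun m : ℕ+ => w (j, m)) ~[atTop] (fun m : ℕ+ => δ j * (((m : ℝ) ^ α j : ℝ) : ℂ))

open MeasureTheory Set Topology

/-! Put κₙ = iωₙ and a = 2Δ − d. The poles lie in the open lower half plane, so Re κₙ > 0, and on
the real axis the product formula reads ∏(1 + x²/κₙ²) = μ sinh(βx/2)/ρ(x). Hence Σ log(1 + x²/κₙ²) =
βx/2 − (a/2) log(1 + x²) + const + o(1) as x → +∞.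

The function log(1 + z/κ) is holomorphic on Re z > 0, and log(1 + t²/κ²) is the sum of its boundary
values at ±it. Integrated over t > 0 against the Poisson kernel y/(t² + y²) it therefore gives π
log(1 + y/κ). Two derivatives in y improve the decay of the kernel to t⁻⁴ and turn the result into
−π/(κ + y)², which is absolutely summable over branches of at least linear growth; see
`integral_log_mul_kernel`. Applied to both sides of the expansion
(`tendsto_sq_mul_tsum_of_log_asymptotics`) this yields y² Σ 1/(κₙ + y)² − βy/(2π) → −a/2.

The left side is also computed branch by branch. A branch κ₀(m + ξ) + o(1), m ≥ 1, contributes y/κ₀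
− (1/2 + ξ) + o(1), by comparison with a telescoping series (`tendsto_sq_mul_tsum_of_linear`).
Matching the coefficient of y and then the constant term gives the two identities of (i), since 1/(i
d) = −i/d. For (ii) one divides by y: a branch with α = 1 contributes 1/κ₀
(`tendsto_mul_tsum_of_linear`), and one with α > 1 contributes nothing
(`tendsto_mul_tsum_of_superlinear`). -/

/-! ### Uniform integral bounds for the logarithms -/

/-- Trades the logarithmic singularity at z = −1 for an integrable inverse square root, while
keeping the linear vanishing at z = 0. -/
lemma norm_log_one_add_le_div_sqrt {z : ℂ} (hz : 1 + z ≠ 0) :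
    ‖Complex.log (1 + z)‖ ≤ 20 * ‖z‖ / √‖1 + z‖ := by
  have ht : 0 < ‖1 + z‖ := norm_pos_iff.2 hz
  have hle : ‖1 + z‖ ≤ 1 + ‖z‖ := by simpa using norm_add_le 1 z
  have hs : 0 < √‖1 + z‖ := Real.sqrt_pos.2 ht
  have hss : √‖1 + z‖ * √‖1 + z‖ = ‖1 + z‖ := Real.mul_self_sqrt ht.le
  rw [le_div_iff₀ hs]
  rcases le_or_gt ‖z‖ (1 / 2) with h | h
  · have h1 := Complex.norm_log_one_add_half_le_self h
    have h2 : √‖1 + z‖ ≤ 2 := by nlinarith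
    nlinarith [norm_nonneg z, norm_nonneg (Complex.log (1 + z))]
  · have h1 : ‖Complex.log (1 + z)‖ ≤ |Real.log ‖1 + z‖| + Real.pi := by
      refine (Complex.norm_le_abs_re_add_abs_im _).trans ?_
      rw [Complex.log_re, Complex.log_im]
      gcongr
      exact Complex.abs_arg_le_pi _
    have h4 : |Real.log ‖1 + z‖| * √‖1 + z‖ ≤ 6 * ‖z‖ := by
      have e : Real.log ‖1 + z‖ = 2 * Real.log (√‖1 + z‖) := by
        rw [Real.log_sqrt ht.le]; ring
      have u1 := Real.log_le_sub_one_of_pos hs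
      have u2 := Real.log_le_sub_one_of_pos (inv_pos.2 hs)
      rw [Real.log_inv] at u2
      have u3 : (√‖1 + z‖)⁻¹ * √‖1 + z‖ = 1 := inv_mul_cancel₀ hs.ne'
      rcases abs_cases (Real.log ‖1 + z‖) with ⟨h5, _⟩ | ⟨h5, _⟩ <;> rw [h5, e] <;> nlinarith
    have h5 : √‖1 + z‖ ≤ 3 * ‖z‖ := by
      by_contra! hc
      nlinarith
    -- The constant: 6 + 3π < 20.
    nlinarith [Real.pi_lt_four, Real.pi_pos, norm_nonneg z]

/-- A value 1 + u² ≤ 0 would force u = t/κ to be purely imaginary and non-zero, hence κ too. So the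
principal logarithm is continuous in t and no branch has to be tracked. -/
lemma one_add_div_sq_mem_slitPlane {κ : ℂ} (hκ : 0 < κ.re) (t : ℝ) :
    1 + (t / κ : ℂ) ^ 2 ∈ Complex.slitPlane := by
  have hκ0 : κ ≠ 0 := by rintro rfl; simp at hκ
  by_contra hc
  rw [Complex.mem_slitPlane_iff] at hc
  push Not at hc
  obtain ⟨h1, h2⟩ := hc
  set u : ℂ := (t / κ : ℂ) with hu
  have hut : u * κ = t := by rw [hu]; field_simp
  have e1 := congrArg Complex.re hut
  have e2 := congrArg Complex.im hut
  simp [pow_two] at h1 h2 e1 e2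
  rcases mul_eq_zero.1 (show u.re * u.im = 0 by linarith) with h | h
  · rw [h] at h1 e2 e1
    have : u.im = 0 := by
      have : u.im * κ.re = 0 := by linarith
      exact (mul_eq_zero.1 this).resolve_right hκ.ne'
    rw [this] at h1
    norm_num at h1
  · rw [h] at h1
    nlinarith

lemma abs_one_sub_sq_le_norm {κ : ℂ} (t : ℝ) :
    |1 - (t / ‖κ‖) ^ 2| ≤ ‖1 + (t / κ : ℂ) ^ 2‖ := by
  have := abs_norm_sub_norm_le (1 : ℂ) (-(t / κ : ℂ) ^ 2)
  simpa [div_pow] using this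

/-- A kernel on the half line: the second `y`-derivative at `y = 1` of `y / (t ^ 2 + y ^ 2)`. -/
noncomputable def poissonKernelDeriv (t : ℝ) : ℝ := 2 * (1 - 3 * t ^ 2) / (1 + t ^ 2) ^ 3

lemma continuous_poissonKernelDeriv : Continuous poissonKernelDeriv := by
  unfold poissonKernelDeriv
  refine Continuous.div (by fun_prop) (by fun_prop) fun t => by positivity

lemma abs_poissonKernelDeriv_le (t : ℝ) : |poissonKernelDeriv t| ≤ 6 / (1 + t ^ 2) ^ 2 := by
  unfold poissonKernelDeriv
  rw [abs_div, abs_of_pos (show 0 < (1 + t ^ 2) ^ 3 by positivity),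
    div_le_div_iff₀ (by positivity) (by positivity)]
  have : |2 * (1 - 3 * t ^ 2)| ≤ 6 * (1 + t ^ 2) := by
    rw [abs_le]; constructor <;> nlinarith [sq_nonneg t]
  calc _ ≤ 6 * (1 + t ^ 2) * (1 + t ^ 2) ^ 2 := by gcongr
    _ = _ := by ring

/-- A pure power lets the integral be rescaled by ‖κ‖. The exponent 5/2 leaves integrable behaviour
at both 0 and ∞ against the logarithm and ends in the summable power ‖κ‖^(-3/2). -/
lemma abs_poissonKernelDeriv_le_rpow {t : ℝ} (ht : 0 < t) :
    |poissonKernelDeriv t| ≤ 6 * t ^ (-(5 / 2) : ℝ) := by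
  refine (abs_poissonKernelDeriv_le t).trans ?_
  rw [Real.rpow_neg ht.le, ← div_eq_mul_inv]
  gcongr
  have h1 : (1 : ℝ) ≤ 1 + t ^ 2 := by nlinarith [sq_nonneg t]
  calc t ^ (5 / 2 : ℝ) = (t ^ 2) ^ (5 / 4 : ℝ) := by
        rw [← Real.rpow_natCast, ← Real.rpow_mul ht.le]; norm_num
    _ ≤ (1 + t ^ 2) ^ (5 / 4 : ℝ) := by gcongr; linarith
    _ ≤ (1 + t ^ 2) ^ (2 : ℝ) := Real.rpow_le_rpow_of_exponent_le h1 (by norm_num)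
    _ = _ := by norm_num

/-- The function is of size t^(-1/2) at 0, |1 − t|^(-1/2) at 1 and t^(-3/2) at infinity. -/
lemma integrableOn_rpow_mul_abs_one_sub_sq :
    IntegrableOn (fun t : ℝ => t ^ (-(1 / 2) : ℝ) * (√|1 - t ^ 2|)⁻¹) (Ioi 0) := by
  have hm : Measurable fun t : ℝ => t ^ (-(1 / 2) : ℝ) * (√|1 - t ^ 2|)⁻¹ := by fun_prop
  have hr (c : ℝ) : IntegrableOn (fun t : ℝ => (t ^ (-(1 / 2) : ℝ))) (Ioc 0 c) :=
    (intervalIntegral.intervalIntegrable_rpow' (by norm_num)).1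
  have hsq (u : ℝ) (hu : 0 ≤ u) : (√u)⁻¹ = u ^ (-(1 / 2) : ℝ) := by
    rw [Real.rpow_neg hu, Real.sqrt_eq_rpow]
  have A : IntegrableOn (fun t : ℝ => t ^ (-(1 / 2) : ℝ) * (√|1 - t ^ 2|)⁻¹) (Ioc 0 (1 / 2)) := by
    refine Integrable.mono' ((hr (1 / 2)).const_mul 2) hm.aestronglyMeasurable ?_
    filter_upwards [ae_restrict_mem measurableSet_Ioc] with t ht
    have h0 : 0 < t ^ (-(1 / 2) : ℝ) := Real.rpow_pos_of_pos ht.1 _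
    rw [Real.norm_of_nonneg (by positivity), mul_comm]
    gcongr
    rw [inv_le_comm₀ (by rw [Real.sqrt_pos, abs_pos]; nlinarith [ht.1, ht.2]) (by norm_num)]
    apply Real.le_sqrt_of_sq_le
    rw [abs_of_nonneg] <;> nlinarith [ht.1, ht.2]
  have B : IntegrableOn (fun t : ℝ => t ^ (-(1 / 2) : ℝ) * (√|1 - t ^ 2|)⁻¹) (Ioc (1 / 2) 1) := by
    have h1 : IntegrableOn (fun t : ℝ => ((1 - t) ^ (-(1 / 2) : ℝ))) (Ioc (1 / 2) 1) := by
      have := (intervalIntegral.intervalIntegrable_rpow' (a := 1 / 2) (b := 0)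
        (r := -(1 / 2)) (by norm_num)).comp_sub_left 1
      norm_num at this
      rw [intervalIntegrable_iff_integrableOn_Ioc_of_le (by norm_num)] at this
      simpa using this
    refine Integrable.mono' (h1.const_mul 2) hm.aestronglyMeasurable ?_
    filter_upwards [ae_restrict_mem measurableSet_Ioc] with t ht
    have ht0 : 0 < t := by linarith [ht.1]
    have h0 : 0 < t ^ (-(1 / 2) : ℝ) := Real.rpow_pos_of_pos ht0 _
    rw [Real.norm_of_nonneg (by positivity)]
    -- At t = 1 the singular factor takes the default value `0⁻¹ = 0`.
    rcases ht.2.eq_or_lt with rfl | hlt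
    · simp
    rw [← hsq (1 - t) (by linarith)]
    gcongr
    · rw [← hsq _ ht0.le, inv_le_comm₀ (by positivity) (by norm_num)]
      apply Real.le_sqrt_of_sq_le
      linarith [ht.1]
    · rw [abs_of_nonneg] <;> nlinarith
  have D : IntegrableOn (fun t : ℝ => t ^ (-(1 / 2) : ℝ) * (√|1 - t ^ 2|)⁻¹) (Ioc 1 2) := by
    have h1 : IntegrableOn (fun t : ℝ => ((t - 1) ^ (-(1 / 2) : ℝ))) (Ioc 1 2) := by
      have := (intervalIntegral.intervalIntegrable_rpow' (a := 0) (b := 1)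
        (r := -(1 / 2)) (by norm_num)).comp_sub_right 1
      norm_num at this
      rw [intervalIntegrable_iff_integrableOn_Ioc_of_le (by norm_num)] at this
      simpa using this
    refine Integrable.mono' h1 hm.aestronglyMeasurable ?_
    filter_upwards [ae_restrict_mem measurableSet_Ioc] with t ht
    have ht0 : 0 < t := by linarith [ht.1]
    have h0 : 0 < t ^ (-(1 / 2) : ℝ) := Real.rpow_pos_of_pos ht0 _
    have h2 : 0 < t - 1 := by linarith [ht.1]
    rw [Real.norm_of_nonneg (by positivity), ← hsq _ h2.le, ← one_mul (√(t - 1))⁻¹]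
    gcongr
    · exact Real.rpow_le_one_of_one_le_of_nonpos ht.1.le (by norm_num)
    · rw [abs_of_neg] <;> nlinarith
  have E : IntegrableOn (fun t : ℝ => t ^ (-(1 / 2) : ℝ) * (√|1 - t ^ 2|)⁻¹) (Ioi 2) := by
    have h1 : IntegrableOn (fun t : ℝ => t ^ (-(3 / 2) : ℝ)) (Ioi 2) :=
      integrableOn_Ioi_rpow_of_lt (by norm_num) (by norm_num)
    refine Integrable.mono' (h1.const_mul 2) hm.aestronglyMeasurable ?_
    filter_upwards [ae_restrict_mem measurableSet_Ioi] with t ht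
    have ht2 : 2 < t := ht
    have ht0 : 0 < t := by linarith
    have h0 : 0 < t ^ (-(1 / 2) : ℝ) := Real.rpow_pos_of_pos ht0 _
    have e : (t ^ (-(3 / 2) : ℝ)) = t ^ (-(1 / 2) : ℝ) * t⁻¹ := by
      rw [← Real.rpow_neg_one, ← Real.rpow_add ht0]; norm_num
    rw [Real.norm_of_nonneg (by positivity), e, mul_left_comm]
    gcongr
    rw [← inv_inv (2 : ℝ), ← mul_inv]
    gcongr
    apply Real.le_sqrt_of_sq_le
    rw [abs_of_neg] <;> nlinarith
  have := ((A.union B).union D).union E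
  refine this.mono_set fun t ht => ?_
  simp only [mem_union, mem_Ioc, mem_Ioi] at ht ⊢
  grind

/-- The logarithmic potential of the pair of zeros `±iκ`, weighted by the kernel. -/
lemma norm_log_mul_kernel_le {κ : ℂ} (hκ : 0 < κ.re) {t : ℝ} (ht : 0 < t) (h1 : t ≠ ‖κ‖) :
    ‖Complex.log (1 + (t / κ : ℂ) ^ 2) * poissonKernelDeriv t‖ ≤
      120 * ‖κ‖ ^ (-(5 / 2) : ℝ) *
        ((t / ‖κ‖) ^ (-(1 / 2) : ℝ) * (√|1 - (t / ‖κ‖) ^ 2|)⁻¹) := by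
  have hκ0 : 0 < ‖κ‖ := norm_pos_iff.2 (by rintro rfl; simp at hκ)
  set r := t / ‖κ‖ with hr
  have hr0 : 0 < r := by positivity
  have hr1 : r ≠ 1 := by
    intro h; apply h1; rw [hr] at h; field_simp at h; exact h
  have hpos : 0 < |1 - r ^ 2| := by
    rw [abs_pos, sub_ne_zero]
    intro h
    exact hr1 (by nlinarith)
  have hb := norm_log_one_add_le_div_sqrt
    (Complex.slitPlane_ne_zero (one_add_div_sq_mem_slitPlane hκ t))
  have hz : ‖(t / κ : ℂ) ^ 2‖ = r ^ 2 := by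
    simp [hr, div_pow]
  rw [hz] at hb
  have hb2 : ‖Complex.log (1 + (t / κ : ℂ) ^ 2)‖ ≤ 20 * r ^ 2 * (√|1 - r ^ 2|)⁻¹ := by
    refine hb.trans ?_
    rw [div_eq_mul_inv]
    gcongr
    exact abs_one_sub_sq_le_norm t
  have hk := abs_poissonKernelDeriv_le_rpow ht
  have htr : t = ‖κ‖ * r := by rw [hr]; field_simp
  have e : t ^ (-(5 / 2) : ℝ) = ‖κ‖ ^ (-(5 / 2) : ℝ) * (r ^ (-(1 / 2) : ℝ) * (r ^ 2)⁻¹) := by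
    rw [htr, Real.mul_rpow hκ0.le hr0.le, ← Real.rpow_natCast, ← Real.rpow_neg hr0.le,
      ← Real.rpow_add hr0]
    norm_num
  rw [norm_mul, Complex.norm_real, Real.norm_eq_abs]
  calc _ ≤ (20 * r ^ 2 * (√|1 - r ^ 2|)⁻¹) * (6 * t ^ (-(5 / 2) : ℝ)) := by gcongr
    _ = _ := by rw [e]; field_simp; ring

lemma integrableOn_comp_div {c : ℝ} (hc : 0 < c) :
    IntegrableOn (fun t : ℝ => (t / c) ^ (-(1 / 2) : ℝ) * (√|1 - (t / c) ^ 2|)⁻¹) (Ioi 0) := by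
  have := (integrableOn_Ioi_comp_mul_right_iff
    (fun t : ℝ => t ^ (-(1 / 2) : ℝ) * (√|1 - t ^ 2|)⁻¹) 0 (inv_pos.2 hc)).2
    (by simpa using integrableOn_rpow_mul_abs_one_sub_sq)
  simpa [div_eq_mul_inv] using this

lemma continuous_log_one_add_div_sq {κ : ℂ} (hκ : 0 < κ.re) :
    Continuous fun t : ℝ => Complex.log (1 + (t / κ : ℂ) ^ 2) := by
  refine Continuous.clog (by fun_prop) fun t => one_add_div_sq_mem_slitPlane hκ t

/-- Removes t = ‖κ‖, where the majorant degenerates to 0 by the convention `0⁻¹ = 0`. -/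
lemma ae_ne_restrict_Ioi (c : ℝ) : ∀ᵐ t ∂(volume.restrict (Ioi (0 : ℝ))), t ≠ c :=
  ae_restrict_of_ae (by simp [ae_iff])

lemma integrableOn_log_mul_kernel {κ : ℂ} (hκ : 0 < κ.re) :
    IntegrableOn (fun t : ℝ => Complex.log (1 + (t / κ : ℂ) ^ 2) * poissonKernelDeriv t)
      (Ioi 0) := by
  have hκ0 : 0 < ‖κ‖ := norm_pos_iff.2 (by rintro rfl; simp at hκ)
  refine Integrable.mono' ((integrableOn_comp_div hκ0).const_mul (120 * ‖κ‖ ^ (-(5 / 2) : ℝ))) ?_ ?_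
  · refine Continuous.aestronglyMeasurable ?_
    exact (continuous_log_one_add_div_sq hκ).mul
      (Complex.continuous_ofReal.comp continuous_poissonKernelDeriv)
  · filter_upwards [ae_restrict_mem measurableSet_Ioi, ae_ne_restrict_Ioi ‖κ‖] with t ht h1
    exact norm_log_mul_kernel_le hκ ht h1

/-- Substituting t = ‖κ‖ r makes the constant independent of κ, even when κ approaches the imaginary
axis and the singularity approaches the path of integration. -/
lemma exists_integral_norm_log_mul_kernel_le : ∃ C : ℝ, ∀ κ : ℂ, 0 < κ.re →
    ∫ t in Ioi (0 : ℝ), ‖Complex.log (1 + (t / κ : ℂ) ^ 2) * poissonKernelDeriv t‖ ≤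
      C * ‖κ‖ ^ (-(3 / 2) : ℝ) := by
  refine ⟨120 * ∫ t in Ioi (0 : ℝ), t ^ (-(1 / 2) : ℝ) * (√|1 - t ^ 2|)⁻¹, fun κ hκ => ?_⟩
  have hκ0 : 0 < ‖κ‖ := norm_pos_iff.2 (by rintro rfl; simp at hκ)
  calc _ ≤ ∫ t in Ioi (0 : ℝ), 120 * ‖κ‖ ^ (-(5 / 2) : ℝ) *
        ((t / ‖κ‖) ^ (-(1 / 2) : ℝ) * (√|1 - (t / ‖κ‖) ^ 2|)⁻¹) := by
        refine integral_mono_ae (integrableOn_log_mul_kernel hκ).norm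
          ((integrableOn_comp_div hκ0).const_mul _) ?_
        filter_upwards [ae_restrict_mem measurableSet_Ioi, ae_ne_restrict_Ioi ‖κ‖] with t ht h1
        exact norm_log_mul_kernel_le hκ ht h1
    _ = _ := by
        rw [integral_const_mul]
        have := integral_comp_mul_right_Ioi
          (fun t : ℝ => t ^ (-(1 / 2) : ℝ) * (√|1 - t ^ 2|)⁻¹) 0 (inv_pos.2 hκ0)
        simp only [← div_eq_mul_inv, zero_div, inv_inv, smul_eq_mul] at this ⊢
        rw [this]
        have e : ‖κ‖ ^ (-(3 / 2) : ℝ) = ‖κ‖ ^ (-(5 / 2) : ℝ) * ‖κ‖ := by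
          rw [← Real.rpow_add_one hκ0.ne']; norm_num
        rw [e]; ring

/-! ### Closed form of the weighted integral of one logarithm -/

lemma hasDerivAt_div_one_add_sq (t : ℝ) :
    HasDerivAt (fun t : ℝ => 2 * t / (1 + t ^ 2) ^ 2) (poissonKernelDeriv t) t := by
  have h1 : HasDerivAt (fun t : ℝ => 2 * t) 2 t := by simpa using (hasDerivAt_id t).const_mul 2
  have h2 : HasDerivAt (fun t : ℝ => (1 + t ^ 2) ^ 2) (2 * (1 + t ^ 2) * (2 * t)) t := by
    simpa using ((hasDerivAt_pow 2 t).const_add 1).fun_pow 2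
  have h0 : (1 + t ^ 2) ≠ 0 := by positivity
  refine (h1.div h2 (by positivity)).congr_deriv ?_
  unfold poissonKernelDeriv
  field_simp
  ring

lemma tendsto_div_one_add_sq_atTop :
    Tendsto (fun t : ℝ => 1 / (1 + t ^ 2)) atTop (𝓝 0) := by
  refine Tendsto.div_atTop tendsto_const_nhds ?_
  exact tendsto_atTop_add_const_left _ _ (tendsto_pow_atTop (by norm_num))

/-- The boundary term of the integration by parts. -/
lemma tendsto_log_mul_atTop {κ : ℂ} (hκ : 0 < κ.re) :
    Tendsto (fun t : ℝ => Complex.log (1 + (t / κ : ℂ) ^ 2) * (2 * t / (1 + t ^ 2) ^ 2 : ℝ))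
      atTop (𝓝 0) := by
  have hκ0 : 0 < ‖κ‖ := norm_pos_iff.2 (by rintro rfl; simp at hκ)
  have h := (tendsto_div_one_add_sq_atTop).const_mul (80 / ‖κ‖)
  rw [mul_zero] at h
  refine squeeze_zero_norm' ?_ h
  filter_upwards [eventually_ge_atTop (2 * ‖κ‖)] with t ht
  have ht0 : 0 < t := by linarith
  have hb := norm_log_one_add_le_div_sqrt
    (Complex.slitPlane_ne_zero (one_add_div_sq_mem_slitPlane hκ t))
  have hz : ‖(t / κ : ℂ) ^ 2‖ = (t / ‖κ‖) ^ 2 := by simp [div_pow]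
  have hr : 2 ≤ t / ‖κ‖ := by rwa [le_div_iff₀ hκ0]
  have h2 := abs_one_sub_sq_le_norm (κ := κ) t
  set r := t / ‖κ‖ with hrdef
  have h3 : r / 2 ≤ √‖1 + (t / κ : ℂ) ^ 2‖ := by
    apply Real.le_sqrt_of_sq_le
    refine le_trans ?_ h2
    rw [abs_of_neg] <;> nlinarith
  have h4 : ‖Complex.log (1 + (t / κ : ℂ) ^ 2)‖ ≤ 40 * r := by
    refine hb.trans ?_
    rw [hz, div_le_iff₀ (by linarith)]
    nlinarith
  rw [norm_mul, Complex.norm_real, Real.norm_of_nonneg (by positivity)]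
  calc _ ≤ 40 * r * (2 * t / (1 + t ^ 2) ^ 2) := by gcongr
    _ = 80 / ‖κ‖ * (t ^ 2 / (1 + t ^ 2) ^ 2) := by rw [hrdef]; ring
    _ ≤ 80 / ‖κ‖ * ((1 + t ^ 2) / (1 + t ^ 2) ^ 2) := by gcongr; linarith
    _ = _ := by congr 1; field_simp

lemma add_I_mul_mem_slitPlane {κ : ℂ} (hκ : 0 < κ.re) (t : ℝ) :
    κ + Complex.I * t ∈ Complex.slitPlane := Or.inl (by simpa using hκ)

lemma sub_I_mul_mem_slitPlane {κ : ℂ} (hκ : 0 < κ.re) (t : ℝ) :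
    κ - Complex.I * t ∈ Complex.slitPlane := Or.inl (by simpa using hκ)

lemma add_sq_ne_zero {κ : ℂ} (hκ : 0 < κ.re) (t : ℝ) : κ ^ 2 + (t : ℂ) ^ 2 ≠ 0 := by
  have e : κ ^ 2 + (t : ℂ) ^ 2 = (κ + Complex.I * t) * (κ - Complex.I * t) := by
    linear_combination ((t : ℂ) ^ 2) * Complex.I_sq
  rw [e]
  exact mul_ne_zero (Complex.slitPlane_ne_zero (add_I_mul_mem_slitPlane hκ t))
    (Complex.slitPlane_ne_zero (sub_I_mul_mem_slitPlane hκ t))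

/-- An antiderivative of `1 / (κ ^ 2 + t ^ 2)`. -/
noncomputable def cArctan (κ : ℂ) (t : ℝ) : ℂ :=
  (Complex.log (κ + Complex.I * t) - Complex.log (κ - Complex.I * t)) / (2 * Complex.I * κ)

lemma hasDerivAt_cArctan {κ : ℂ} (hκ : 0 < κ.re) (t : ℝ) :
    HasDerivAt (cArctan κ) (1 / (κ ^ 2 + (t : ℂ) ^ 2)) t := by
  have hκ0 : κ ≠ 0 := by rintro rfl; simp at hκ
  have ho : HasDerivAt (fun t : ℝ => Complex.I * (t : ℂ)) Complex.I t := by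
    simpa using (Complex.ofRealCLM.hasDerivAt (x := t)).const_mul Complex.I
  have h1 := (ho.const_add κ).clog_real (add_I_mul_mem_slitPlane hκ t)
  have h2 := (ho.const_sub κ).clog_real (sub_I_mul_mem_slitPlane hκ t)
  have n1 := Complex.slitPlane_ne_zero (add_I_mul_mem_slitPlane hκ t)
  have n2 := Complex.slitPlane_ne_zero (sub_I_mul_mem_slitPlane hκ t)
  refine ((h1.sub h2).div_const (2 * Complex.I * κ)).congr_deriv ?_
  have e : κ ^ 2 + (t : ℂ) ^ 2 = (κ + Complex.I * t) * (κ - Complex.I * t) := by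
    linear_combination ((t : ℂ) ^ 2) * Complex.I_sq
  rw [e]
  field_simp [Complex.I_ne_zero]
  ring

lemma cArctan_zero (κ : ℂ) : cArctan κ 0 = 0 := by simp [cArctan]

/-- Factoring t out of κ ± it cancels log t, leaving (log i − log(−i))/(2iκ). -/
lemma tendsto_cArctan {κ : ℂ} (hκ : 0 < κ.re) :
    Tendsto (cArctan κ) atTop (𝓝 (Real.pi / (2 * κ))) := by
  have hκ0 : κ ≠ 0 := by rintro rfl; simp at hκ
  have hz : Tendsto (fun t : ℝ => κ / (t : ℂ)) atTop (𝓝 0) := by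
    have := (Complex.continuous_ofReal.tendsto _).comp tendsto_inv_atTop_zero
    simpa [div_eq_mul_inv] using this.const_mul κ
  have h1 : Tendsto (fun t : ℝ => Complex.log (Complex.I + κ / t)) atTop
      (𝓝 (Complex.log Complex.I)) := by
    have := hz.const_add Complex.I
    rw [add_zero] at this
    exact this.clog (Or.inr (by simp))
  have h2 : Tendsto (fun t : ℝ => Complex.log (-Complex.I + κ / t)) atTop
      (𝓝 (Complex.log (-Complex.I))) := by
    have := hz.const_add (-Complex.I)
    rw [add_zero] at this
    exact this.clog (Or.inr (by simp))
  have h3 := (h1.sub h2).div_const (2 * Complex.I * κ)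
  have e : (Complex.log Complex.I - Complex.log (-Complex.I)) / (2 * Complex.I * κ) =
      Real.pi / (2 * κ) := by
    rw [Complex.log_I, Complex.log_neg_I]
    field_simp [Complex.I_ne_zero]
    ring
  rw [e] at h3
  refine h3.congr' ?_
  filter_upwards [eventually_gt_atTop 0] with t ht
  have ht0 : (t : ℂ) ≠ 0 := by exact_mod_cast ht.ne'
  have e1 : κ + Complex.I * t = (t : ℂ) * (Complex.I + κ / t) := by field_simp; ring
  have e2 : κ - Complex.I * t = (t : ℂ) * (-Complex.I + κ / t) := by field_simp; ring
  have n1 := Complex.slitPlane_ne_zero (add_I_mul_mem_slitPlane hκ t)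
  have n2 := Complex.slitPlane_ne_zero (sub_I_mul_mem_slitPlane hκ t)
  rw [e1] at n1
  rw [e2] at n2
  rw [cArctan, e1, e2, Complex.log_ofReal_mul ht (right_ne_zero_of_mul n1),
    Complex.log_ofReal_mul ht (right_ne_zero_of_mul n2)]
  ring

lemma hasDerivAt_log_one_add_div_sq {κ : ℂ} (hκ : 0 < κ.re) (t : ℝ) :
    HasDerivAt (fun t : ℝ => Complex.log (1 + (t / κ : ℂ) ^ 2))
      (2 * t / (κ ^ 2 + (t : ℂ) ^ 2)) t := by
  have hκ0 : κ ≠ 0 := by rintro rfl; simp at hκ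
  have ho : HasDerivAt (fun t : ℝ => (t : ℂ) / κ) (1 / κ) t := by
    simpa using (Complex.ofRealCLM.hasDerivAt (x := t)).div_const κ
  have h1 := ((ho.fun_pow 2).const_add 1).clog_real (one_add_div_sq_mem_slitPlane hκ t)
  refine h1.congr_deriv ?_
  have n := Complex.slitPlane_ne_zero (one_add_div_sq_mem_slitPlane hκ t)
  have n2 := add_sq_ne_zero hκ t
  rw [div_eq_div_iff n n2]
  push_cast
  field_simp

/-- If `A` is an antiderivative of the rational function arising from an integration by parts, the
weighted integral of the logarithm is read off from the limit of `A`. -/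
lemma integral_log_mul_kernel_of_hasDerivAt {κ a : ℂ} (hκ : 0 < κ.re) {A : ℝ → ℂ}
    (hA : ∀ t : ℝ, HasDerivAt A ((t : ℂ) ^ 2 / ((κ ^ 2 + (t : ℂ) ^ 2) * (1 + (t : ℂ) ^ 2) ^ 2)) t)
    (hA0 : A 0 = 0) (ha : Tendsto A atTop (𝓝 a)) :
    ∫ t in Ioi (0 : ℝ), Complex.log (1 + (t / κ : ℂ) ^ 2) * poissonKernelDeriv t = -4 * a := by
  have hd (t : ℝ) := ((hasDerivAt_log_one_add_div_sq hκ t).mul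
    (hasDerivAt_div_one_add_sq t).ofReal_comp).sub ((hA t).const_mul 4)
  have hd' (t : ℝ) : HasDerivAt (fun t : ℝ => Complex.log (1 + (t / κ : ℂ) ^ 2) *
      (2 * t / (1 + t ^ 2) ^ 2 : ℝ) - 4 * A t)
      (Complex.log (1 + (t / κ : ℂ) ^ 2) * poissonKernelDeriv t) t := by
    refine (hd t).congr_deriv ?_
    have n1 := add_sq_ne_zero hκ t
    have n2 : 1 + (t : ℂ) ^ 2 ≠ 0 := by
      simpa using add_sq_ne_zero (κ := 1) (by simp) t
    push_cast
    field_simp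
    ring
  have hl := (tendsto_log_mul_atTop hκ).sub (ha.const_mul 4)
  rw [integral_Ioi_of_hasDerivAt_of_tendsto (hd' 0).continuousAt.continuousWithinAt
    (fun t _ => hd' t) (integrableOn_log_mul_kernel hκ) hl]
  simp [hA0]

lemma hasDerivAt_ofReal_arctan (t : ℝ) :
    HasDerivAt (fun t : ℝ => (Real.arctan t : ℂ)) (1 / (1 + (t : ℂ) ^ 2)) t := by
  refine (Real.hasDerivAt_arctan t).ofReal_comp.congr_deriv ?_
  push_cast; rfl

lemma tendsto_ofReal_arctan :
    Tendsto (fun t : ℝ => (Real.arctan t : ℂ)) atTop (𝓝 (Real.pi / 2)) := by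
  have h := Real.tendsto_arctan_atTop.mono_right nhdsWithin_le_nhds
  have := (Complex.continuous_ofReal.tendsto _).comp h
  push_cast at this
  exact this

lemma one_add_ofReal_sq_ne_zero (t : ℝ) : 1 + (t : ℂ) ^ 2 ≠ 0 := by
  simpa using add_sq_ne_zero (κ := 1) (by simp) t

lemma hasDerivAt_ofReal_div_one_add_sq (t : ℝ) :
    HasDerivAt (fun t : ℝ => (t : ℂ) / (1 + (t : ℂ) ^ 2))
      ((1 - (t : ℂ) ^ 2) / (1 + (t : ℂ) ^ 2) ^ 2) t := by
  have ho : HasDerivAt (fun t : ℝ => (t : ℂ)) 1 t := Complex.ofRealCLM.hasDerivAt (x := t)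
  refine (ho.fun_div ((ho.fun_pow 2).const_add 1) (one_add_ofReal_sq_ne_zero t)).congr_deriv ?_
  congr 1
  push_cast
  ring

lemma tendsto_ofReal_div_one_add_sq :
    Tendsto (fun t : ℝ => (t : ℂ) / (1 + (t : ℂ) ^ 2)) atTop (𝓝 0) := by
  have h : Tendsto (fun t : ℝ => t / (1 + t ^ 2)) atTop (𝓝 0) := by
    refine squeeze_zero' (g := fun t : ℝ => 1 / t) ?_ ?_ ?_
    · filter_upwards [eventually_gt_atTop 0] with t ht using by positivity
    · filter_upwards [eventually_gt_atTop 0] with t ht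
      rw [div_le_div_iff₀ (by positivity) ht]; nlinarith
    · simpa using tendsto_inv_atTop_zero (𝕜 := ℝ)
  have := (Complex.continuous_ofReal.tendsto _).comp h
  simp only [Function.comp_def] at this
  push_cast at this
  exact this

/-- The case κ = 1 is separate because the poles ±iκ then merge with ±i and the partial fractions of
the general case break down. -/
lemma integral_log_one_add_sq_mul_kernel :
    ∫ t in Ioi (0 : ℝ), Complex.log (1 + (t / 1 : ℂ) ^ 2) * poissonKernelDeriv t =
      -Real.pi / 4 := by
  have hA (t : ℝ) : HasDerivAt (fun t : ℝ => (t : ℂ) / (1 + (t : ℂ) ^ 2) / 8 -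
      (t : ℂ) / (1 + (t : ℂ) ^ 2) * (1 / (1 + (t : ℂ) ^ 2)) / 4 + (Real.arctan t : ℂ) / 8)
      ((t : ℂ) ^ 2 / (((1 : ℂ) ^ 2 + (t : ℂ) ^ 2) * (1 + (t : ℂ) ^ 2) ^ 2)) t := by
    have ho : HasDerivAt (fun t : ℝ => (t : ℂ)) 1 t := Complex.ofRealCLM.hasDerivAt (x := t)
    have n2 := one_add_ofReal_sq_ne_zero t
    have h1 := hasDerivAt_ofReal_div_one_add_sq t
    have h2 := (hasDerivAt_const t (1 : ℂ)).fun_div ((ho.fun_pow 2).const_add 1) n2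
    refine (((h1.div_const 8).sub ((h1.mul h2).div_const 4)).add
      ((hasDerivAt_ofReal_arctan t).div_const 8)).congr_deriv ?_
    push_cast
    field_simp
    ring
  have h2 : Tendsto (fun t : ℝ => 1 / (1 + (t : ℂ) ^ 2)) atTop (𝓝 0) := by
    have := (Complex.continuous_ofReal.tendsto _).comp tendsto_div_one_add_sq_atTop
    simp only [Function.comp_def] at this
    push_cast at this
    exact this
  have hl := ((tendsto_ofReal_div_one_add_sq.div_const 8).sub
    ((tendsto_ofReal_div_one_add_sq.mul h2).div_const 4)).add (tendsto_ofReal_arctan.div_const 8)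
  rw [integral_log_mul_kernel_of_hasDerivAt (by simp) hA (by simp) hl]
  ring

/-- This is the second y-derivative at y = 1 of π log(1 + y/κ), the half-line Poisson integral. It
is verified by an explicit antiderivative instead of differentiating that formula. -/
lemma integral_log_mul_kernel {κ : ℂ} (hκ : 0 < κ.re) :
    ∫ t in Ioi (0 : ℝ), Complex.log (1 + (t / κ : ℂ) ^ 2) * poissonKernelDeriv t =
      -Real.pi / (κ + 1) ^ 2 := by
  have hκ0 : κ ≠ 0 := by rintro rfl; simp at hκ
  have hp : 1 + κ ≠ 0 := by
    intro h
    have := congrArg Complex.re h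
    simp at this
    linarith
  rcases eq_or_ne κ 1 with rfl | h1
  · rw [integral_log_one_add_sq_mul_kernel]; norm_num
  have hm : 1 - κ ≠ 0 := sub_ne_zero.2 h1.symm
  -- Partial fractions in t², with 1/(κ² + t²), 1/(1 + t²) and 1/(1 + t²)² integrated separately.
  have hA (t : ℝ) : HasDerivAt (fun t : ℝ =>
      -(κ ^ 2 / ((1 - κ) * (1 + κ)) ^ 2) * cArctan κ t +
        κ ^ 2 / ((1 - κ) * (1 + κ)) ^ 2 * (Real.arctan t : ℂ) +
        1 / ((1 - κ) * (1 + κ)) * (((t : ℂ) / (1 + (t : ℂ) ^ 2) + (Real.arctan t : ℂ)) / 2))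
      ((t : ℂ) ^ 2 / ((κ ^ 2 + (t : ℂ) ^ 2) * (1 + (t : ℂ) ^ 2) ^ 2)) t := by
    refine ((((hasDerivAt_cArctan hκ t).const_mul _).add
      ((hasDerivAt_ofReal_arctan t).const_mul _)).add
      ((((hasDerivAt_ofReal_div_one_add_sq t).add
        (hasDerivAt_ofReal_arctan t)).div_const 2).const_mul _)).congr_deriv ?_
    have n1 := add_sq_ne_zero hκ t
    have n2 := one_add_ofReal_sq_ne_zero t
    field_simp
    ring
  have hl := (((tendsto_cArctan hκ).const_mul (-(κ ^ 2 / ((1 - κ) * (1 + κ)) ^ 2))).add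
      (tendsto_ofReal_arctan.const_mul (κ ^ 2 / ((1 - κ) * (1 + κ)) ^ 2))).add
      (((tendsto_ofReal_div_one_add_sq.add tendsto_ofReal_arctan).div_const 2).const_mul
        (1 / ((1 - κ) * (1 + κ))))
  rw [integral_log_mul_kernel_of_hasDerivAt hκ hA (by simp [cArctan_zero]) hl, add_comm κ 1]
  field_simp
  ring

/-! ### Summation over the spectrum and rescaling -/

lemma hasSum_integral_log_mul_kernel {ι : Type*} [Countable ι] {κ : ι → ℂ}
    (hκ : ∀ n, 0 < (κ n).re) (hs : Summable fun n => ‖κ n‖ ^ (-(3 / 2) : ℝ)) :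
    HasSum (fun n => -Real.pi / (κ n + 1) ^ 2)
      (∫ t in Ioi (0 : ℝ), (∑' n, Complex.log (1 + (t / κ n : ℂ) ^ 2)) * poissonKernelDeriv t) := by
  obtain ⟨C, hC⟩ := exists_integral_norm_log_mul_kernel_le
  have := hasSum_integral_of_summable_integral_norm
    (fun n => integrableOn_log_mul_kernel (hκ n))
    (Summable.of_nonneg_of_le (fun n => integral_nonneg fun t => norm_nonneg _)
      (fun n => hC _ (hκ n)) (hs.mul_left C))
  simpa only [integral_log_mul_kernel (hκ _), tsum_mul_right] using this

/-- Dilating t by y is the same as replacing κₙ by κₙ/y, which recovers general y from the kernel at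
y = 1. -/
lemma integral_tsum_log_comp_mul_mul_kernel {ι : Type*} [Countable ι] {κ : ι → ℂ}
    (hκ : ∀ n, 0 < (κ n).re) (hs : Summable fun n => ‖κ n‖ ^ (-(3 / 2) : ℝ)) {y : ℝ} (hy : 0 < y) :
    ∫ t in Ioi (0 : ℝ), (∑' n, Complex.log (1 + ((y * t : ℝ) / κ n : ℂ) ^ 2)) *
      poissonKernelDeriv t = -Real.pi * (y ^ 2 * ∑' n, 1 / (κ n + y) ^ 2) := by
  have hy0 : (y : ℂ) ≠ 0 := by exact_mod_cast hy.ne'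
  have h := hasSum_integral_log_mul_kernel (κ := fun n => κ n / y)
    (fun n => by rw [Complex.div_ofReal_re]; exact div_pos (hκ n) hy) (by
      refine (hs.mul_right (y ^ (-(3 / 2) : ℝ))⁻¹).congr fun n => ?_
      rw [norm_div, Complex.norm_real, Real.norm_of_nonneg hy.le,
        Real.div_rpow (norm_nonneg _) hy.le]
      exact (div_eq_mul_inv _ _).symm)
  have e1 (t : ℝ) (n : ι) : ((y * t : ℝ) / κ n : ℂ) = t / (κ n / y) := by
    push_cast
    rw [div_div_eq_mul_div, mul_comm]
  simp only [e1]
  rw [← h.tsum_eq, ← tsum_mul_left, ← tsum_mul_left]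
  refine tsum_congr fun n => ?_
  have : κ n / y + 1 = (κ n + y) / y := by field_simp
  rw [this, div_pow]
  field_simp

/-! ### Moments of the kernel and transfer of asymptotics -/

lemma integrableOn_poissonKernelDeriv : IntegrableOn poissonKernelDeriv (Ioi 0) := by
  refine Integrable.mono' ((integrable_inv_one_add_sq.const_mul 6).integrableOn)
    continuous_poissonKernelDeriv.aestronglyMeasurable (Eventually.of_forall fun t => ?_)
  rw [Real.norm_eq_abs]
  refine (abs_poissonKernelDeriv_le t).trans ?_
  rw [div_eq_mul_inv]
  gcongr
  nlinarith [sq_nonneg t, sq_nonneg (t ^ 2)]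

lemma integrableOn_mul_poissonKernelDeriv :
    IntegrableOn (fun t => t * poissonKernelDeriv t) (Ioi 0) := by
  refine Integrable.mono' ((integrable_inv_one_add_sq.const_mul 6).integrableOn)
    (continuous_id.mul continuous_poissonKernelDeriv).aestronglyMeasurable
    (Eventually.of_forall fun t => ?_)
  rw [Real.norm_eq_abs, abs_mul]
  calc _ ≤ |t| * (6 / (1 + t ^ 2) ^ 2) := by gcongr; exact abs_poissonKernelDeriv_le t
    _ ≤ (1 + t ^ 2) * (6 / (1 + t ^ 2) ^ 2) := by
        gcongr
        rw [abs_le]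
        constructor <;> nlinarith [sq_nonneg (t - 1), sq_nonneg (t + 1)]
    _ = _ := by field_simp

/-- The integral of y/(t² + y²) over t > 0 is π/2 for every y, so its second derivative vanishes.
This is what removes the unknown constant term of the expansion. -/
lemma integral_poissonKernelDeriv : ∫ t in Ioi (0 : ℝ), poissonKernelDeriv t = 0 := by
  have hl : Tendsto (fun t : ℝ => 2 * t / (1 + t ^ 2) ^ 2) atTop (𝓝 0) := by
    refine squeeze_zero' (g := fun t : ℝ => 1 / (1 + t ^ 2)) ?_ ?_ tendsto_div_one_add_sq_atTop
    · filter_upwards [eventually_gt_atTop 0] with t ht using by positivity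
    · refine Eventually.of_forall fun t => ?_
      rw [div_le_div_iff₀ (by positivity) (by positivity)]
      nlinarith [sq_nonneg (t - 1), sq_nonneg t]
  rw [integral_Ioi_of_hasDerivAt_of_tendsto
    (hasDerivAt_div_one_add_sq 0).continuousAt.continuousWithinAt
    (fun t _ => hasDerivAt_div_one_add_sq t) integrableOn_poissonKernelDeriv hl]
  simp

lemma integral_mul_poissonKernelDeriv :
    ∫ t in Ioi (0 : ℝ), t * poissonKernelDeriv t = -1 := by
  have hd (t : ℝ) : HasDerivAt (fun t : ℝ => 3 * (1 / (1 + t ^ 2)) -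
      2 * ((1 / (1 + t ^ 2)) * (1 / (1 + t ^ 2)))) (t * poissonKernelDeriv t) t := by
    have h0 : (1 + t ^ 2) ≠ 0 := by positivity
    have h1 := (hasDerivAt_const t (1 : ℝ)).fun_div ((hasDerivAt_pow 2 t).const_add 1) h0
    refine ((h1.const_mul 3).sub ((h1.mul h1).const_mul 2)).congr_deriv ?_
    unfold poissonKernelDeriv
    field_simp
    push_cast
    ring
  have hl := (tendsto_div_one_add_sq_atTop.const_mul 3).sub
    ((tendsto_div_one_add_sq_atTop.mul tendsto_div_one_add_sq_atTop).const_mul 2)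
  rw [integral_Ioi_of_hasDerivAt_of_tendsto (hd 0).continuousAt.continuousWithinAt
    (fun t _ => hd t) integrableOn_mul_poissonKernelDeriv hl]
  norm_num

lemma exists_norm_le_of_continuousOn_of_tendsto {e : ℝ → ℂ} (hc : ContinuousOn e (Ici 0))
    (h0 : Tendsto e atTop (𝓝 0)) : ∃ B : ℝ, ∀ x, 0 ≤ x → ‖e x‖ ≤ B := by
  have h1 : ∀ᶠ x in atTop, ‖e x‖ ≤ 1 := by
    filter_upwards [h0.norm.eventually (Iic_mem_nhds (show ‖(0 : ℂ)‖ < 1 by simp))] with x hx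
      using hx
  obtain ⟨R, hR⟩ := eventually_atTop.1 h1
  obtain ⟨B, hB⟩ := isCompact_Icc.exists_bound_of_continuousOn
    (hc.mono (Icc_subset_Ici_self : Icc 0 R ⊆ Ici 0))
  refine ⟨max B 1, fun x hx => ?_⟩
  rcases le_total x R with h | h
  · exact (hB x ⟨hx, h⟩).trans (le_max_left _ _)
  · exact (hR x h).trans (le_max_right _ _)

/-- Dominated convergence: e is bounded, the kernel is integrable, and e(yt) → 0 for each t > 0. -/
lemma tendsto_integral_comp_mul_mul_kernel {e : ℝ → ℂ} (hc : ContinuousOn e (Ici 0))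
    (h0 : Tendsto e atTop (𝓝 0)) :
    (∀ y : ℝ, 0 < y → IntegrableOn (fun t => e (y * t) * poissonKernelDeriv t) (Ioi 0)) ∧
    Tendsto (fun y : ℝ => ∫ t in Ioi (0 : ℝ), e (y * t) * poissonKernelDeriv t) atTop (𝓝 0) := by
  obtain ⟨B, hB⟩ := exists_norm_le_of_continuousOn_of_tendsto hc h0
  have hm (y : ℝ) (hy : 0 < y) : AEStronglyMeasurable (fun t => e (y * t) * poissonKernelDeriv t)
      (volume.restrict (Ioi 0)) := by
    refine ContinuousOn.aestronglyMeasurable ?_ measurableSet_Ioi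
    refine ContinuousOn.mul (hc.comp (by fun_prop) fun t ht => ?_)
      (Complex.continuous_ofReal.comp continuous_poissonKernelDeriv).continuousOn
    exact (mul_pos hy ht).le
  have hb (y : ℝ) (hy : 0 < y) : ∀ᵐ t ∂(volume.restrict (Ioi (0 : ℝ))),
      ‖e (y * t) * poissonKernelDeriv t‖ ≤ B * ‖poissonKernelDeriv t‖ := by
    filter_upwards [ae_restrict_mem measurableSet_Ioi] with t ht
    rw [norm_mul, Complex.norm_real]
    gcongr
    exact hB _ (mul_pos hy ht).le
  have hi : Integrable (fun t => B * ‖poissonKernelDeriv t‖) (volume.restrict (Ioi 0)) :=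
    integrableOn_poissonKernelDeriv.norm.const_mul B
  refine ⟨fun y hy => Integrable.mono' hi (hm y hy) (hb y hy), ?_⟩
  have := tendsto_integral_filter_of_dominated_convergence (μ := volume.restrict (Ioi (0 : ℝ)))
    (F := fun (y : ℝ) t => e (y * t) * poissonKernelDeriv t) (f := fun _ => 0) (l := atTop) _
    ((eventually_gt_atTop 0).mono hm) ((eventually_gt_atTop 0).mono hb) hi ?_
  · simpa using this
  filter_upwards [ae_restrict_mem measurableSet_Ioi] with t ht
  have := (h0.comp (tendsto_id.atTop_mul_const (show 0 < t from ht))).mul_const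
    (poissonKernelDeriv t : ℂ)
  simpa using this

/-- Asymptotics of the second logarithmic derivative of a product `∏ (1 + x / κ n)`, given the
asymptotics of `∏ (1 + x ^ 2 / κ n ^ 2)` along the boundary of the half plane. -/
theorem tendsto_sq_mul_tsum_of_log_asymptotics {ι : Type*} [Countable ι] {κ : ι → ℂ}
    (hκ : ∀ n, 0 < (κ n).re) (hs : Summable fun n => ‖κ n‖ ^ (-(3 / 2) : ℝ)) {A a c : ℂ}
    {e : ℝ → ℂ} (hc : ContinuousOn e (Ici 0)) (h0 : Tendsto e atTop (𝓝 0))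
    (hL : ∀ x : ℝ, 0 ≤ x → ∑' n, Complex.log (1 + (x / κ n : ℂ) ^ 2) =
      A * x - a / 2 * Complex.log (1 + (x : ℂ) ^ 2) + c + e x) :
    Tendsto (fun y : ℝ => (y : ℂ) ^ 2 * ∑' n, 1 / (κ n + y) ^ 2 - A / Real.pi * y) atTop
      (𝓝 (-a / 2)) := by
  obtain ⟨hi, ht⟩ := tendsto_integral_comp_mul_mul_kernel hc h0
  have hpi : (Real.pi : ℂ) ≠ 0 := by exact_mod_cast Real.pi_ne_zero
  have key : ∀ y : ℝ, 0 < y → (y : ℂ) ^ 2 * ∑' n, 1 / (κ n + y) ^ 2 - A / Real.pi * y =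
      -a / 2 * ((y : ℂ) ^ 2 / (1 + y) ^ 2) -
        (∫ t in Ioi (0 : ℝ), e (y * t) * poissonKernelDeriv t) / Real.pi := by
    intro y hy
    have hy0 : (y : ℂ) ≠ 0 := by exact_mod_cast hy.ne'
    have hre : 0 < ((1 / y : ℝ) : ℂ).re := by rw [Complex.ofReal_re]; positivity
    -- The term log(1 + x²) at x = yt is itself a single logarithm with κ = 1/y, so the same closed
    -- form integrates it.
    have e1 (t : ℝ) : (1 + ((y * t : ℝ) : ℂ) ^ 2) = 1 + (t / (1 / y : ℝ) : ℂ) ^ 2 := by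
      push_cast
      field_simp
    have i1 := (integrableOn_log_mul_kernel hre).const_mul (a / 2)
    have i2 : Integrable (fun t : ℝ => A * y * ((t * poissonKernelDeriv t : ℝ) : ℂ))
        (volume.restrict (Ioi 0)) := integrableOn_mul_poissonKernelDeriv.ofReal (𝕜 := ℂ).const_mul (A * y)
    have i3 : Integrable (fun t : ℝ => c * (poissonKernelDeriv t : ℂ))
        (volume.restrict (Ioi 0)) := integrableOn_poissonKernelDeriv.ofReal (𝕜 := ℂ).const_mul c
    have h1 := integral_tsum_log_comp_mul_mul_kernel hκ hs hy
    have h2 : ∫ t in Ioi (0 : ℝ), (∑' n, Complex.log (1 + ((y * t : ℝ) / κ n : ℂ) ^ 2)) *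
        poissonKernelDeriv t = ∫ t in Ioi (0 : ℝ), (A * y * ((t * poissonKernelDeriv t : ℝ) : ℂ)
          - a / 2 * (Complex.log (1 + (t / (1 / y : ℝ) : ℂ) ^ 2) * poissonKernelDeriv t)
          + c * (poissonKernelDeriv t : ℂ) + e (y * t) * poissonKernelDeriv t) := by
      refine setIntegral_congr_fun measurableSet_Ioi fun t ht => ?_
      rw [hL _ (mul_pos hy ht).le, e1]
      push_cast
      ring
    have i4 := i2.sub i1
    have i5 := i4.add i3
    simp only [Pi.sub_def, Pi.add_def] at i4 i5
    rw [h2, integral_add i5 (hi y hy), integral_add i4 i3,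
      integral_sub i2 i1] at h1
    simp only [integral_const_mul] at h1
    have j2 : ∫ t in Ioi (0 : ℝ), ((t * poissonKernelDeriv t : ℝ) : ℂ) = -1 := by
      rw [integral_complex_ofReal, integral_mul_poissonKernelDeriv]; simp
    have j3 : ∫ t in Ioi (0 : ℝ), (poissonKernelDeriv t : ℂ) = 0 := by
      rw [integral_complex_ofReal, integral_poissonKernelDeriv]; simp
    rw [j2, j3, integral_log_mul_kernel hre] at h1
    have n1 : (1 : ℂ) + y ≠ 0 := by
      norm_cast
      positivity
    have e2 : -(Real.pi : ℂ) / (((1 / y : ℝ) : ℂ) + 1) ^ 2 = -Real.pi * (y ^ 2 / (1 + y) ^ 2) := by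
      push_cast
      field_simp
    rw [e2] at h1
    have h3 : (y : ℂ) ^ 2 * ∑' n, 1 / (κ n + y) ^ 2 = -(-(Real.pi : ℂ) *
      (y ^ 2 * ∑' n, 1 / (κ n + y) ^ 2)) / Real.pi := by field_simp
    rw [h3, ← h1]
    field_simp
    ring
  have hy1 : Tendsto (fun y : ℝ => (y : ℂ) ^ 2 / (1 + y) ^ 2) atTop (𝓝 1) := by
    have h : Tendsto (fun y : ℝ => 1 - 1 / (1 + y)) atTop (𝓝 (1 - 0)) :=
      tendsto_const_nhds.sub (tendsto_const_nhds.div_atTop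
        (tendsto_atTop_add_const_left _ _ tendsto_id))
    have h' := (Complex.continuous_ofReal.tendsto _).comp (h.pow 2)
    simp only [sub_zero, one_pow, Complex.ofReal_one] at h'
    refine h'.congr' ?_
    filter_upwards [eventually_gt_atTop 0] with y hy
    have n1 : (1 : ℂ) + y ≠ 0 := by
      norm_cast
      positivity
    simp only [Function.comp_def]
    push_cast
    field_simp
    ring
  have := (hy1.const_mul (-a / 2)).sub (ht.div_const (Real.pi : ℂ))
  simp only [mul_one, zero_div, sub_zero] at this
  refine this.congr' ?_
  filter_upwards [eventually_gt_atTop 0] with y hy using (key y hy).symm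

/-! ### Continuous logarithms and passage from products to sums -/

/-- Two logarithms of c differ by an element of 2πiℤ, and a continuous map from a connected set to a
discrete set is constant. -/
lemma isPreconnected_eq_of_exp_eq {s : Set ℝ} (hs : IsPreconnected s) {v : ℝ → ℂ}
    (hv : ContinuousOn v s) {c : ℂ} (h : ∀ x ∈ s, Complex.exp (v x) = c) {x y : ℝ} (hx : x ∈ s)
    (hy : y ∈ s) : v x = v y := by
  have hint : ∀ z ∈ s, ∃ n : ℤ, v z = v x + n * (2 * Real.pi * Complex.I) := fun z hz =>
    Complex.exp_eq_exp_iff_exists_int.1 ((h z hz).trans (h x hx).symm)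
  have hd : DiscreteTopology (range ((↑) : ℤ → ℝ)) :=
    (Int.isClosedEmbedding_coe_real.isEmbedding.toHomeomorph).symm.isEmbedding.discreteTopology
  have hval : ∀ z (n : ℤ), v z = v x + n * (2 * Real.pi * Complex.I) →
      ((v z - v x).im) / (2 * Real.pi) = n := by
    intro z n hn
    rw [hn]
    simp
  have := hs.constant_of_mapsTo (f := fun z => ((v z - v x).im) / (2 * Real.pi))
    (T := range ((↑) : ℤ → ℝ)) ⟨hd⟩ ?_ ?_ hx hy
  · obtain ⟨n, hn⟩ := hint y hy
    rw [hval y n hn] at this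
    simp only [sub_self, Complex.zero_im, zero_div] at this
    have hn0 : n = 0 := by exact_mod_cast this.symm
    rw [hn, hn0]
    simp
  · exact (Complex.continuous_im.comp_continuousOn (hv.sub continuousOn_const)).div_const _
  · intro z hz
    obtain ⟨n, hn⟩ := hint z hz
    exact ⟨n, (hval z n hn).symm⟩

/-- A continuous logarithm of a function with a non-zero limit has a limit. -/
lemma exists_tendsto_of_tendsto_exp {g : ℝ → ℂ} (hg : Continuous g) {c : ℂ} (hc : c ≠ 0)
    (h : Tendsto (fun x => Complex.exp (g x)) atTop (𝓝 c)) : ∃ b, Tendsto g atTop (𝓝 b) := by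
  have h1 : Tendsto (fun x => Complex.exp (g x) / c) atTop (𝓝 1) := by
    simpa [hc] using h.div_const c
  have h2 : ∀ᶠ x in atTop, Complex.exp (g x) / c ∈ Complex.slitPlane :=
    h1.eventually (Complex.isOpen_slitPlane.mem_nhds Complex.one_mem_slitPlane)
  obtain ⟨X, hX⟩ := eventually_atTop.1 h2
  -- Near infinity v is a continuous logarithm of the constant c, hence constant.
  set v : ℝ → ℂ := fun x => g x - Complex.log (Complex.exp (g x) / c) with hv
  have hvc : ContinuousOn v (Ici X) := by
    refine hg.continuousOn.sub (ContinuousOn.clog ?_ fun x hx => hX x hx)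
    exact (Complex.continuous_exp.comp hg).continuousOn.div_const c
  have hve : ∀ x ∈ Ici X, Complex.exp (v x) = c := by
    intro x _
    have hne : Complex.exp (g x) / c ≠ 0 := div_ne_zero (Complex.exp_ne_zero _) hc
    rw [hv, Complex.exp_sub, Complex.exp_log hne]
    field_simp [Complex.exp_ne_zero]
  refine ⟨v X, ?_⟩
  have h3 := (h1.clog Complex.one_mem_slitPlane).const_add (v X)
  rw [Complex.log_one, add_zero] at h3
  refine h3.congr' ?_
  filter_upwards [eventually_ge_atTop X] with x hx
  rw [isPreconnected_eq_of_exp_eq isPreconnected_Ici hvc hve (mem_Ici.2 le_rfl) (mem_Ici.2 hx)]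
  simp [hv]

lemma summable_div_sq {ι : Type*} {κ : ι → ℂ} (hs : Summable fun n => (‖κ n‖ ^ 2)⁻¹) (x : ℝ) :
    Summable fun n => (x / κ n : ℂ) ^ 2 := by
  refine Summable.of_norm ?_
  refine (hs.mul_left (x ^ 2)).congr fun n => ?_
  rw [norm_pow, norm_div, div_pow, Complex.norm_real, Real.norm_eq_abs, sq_abs, div_eq_mul_inv]

lemma continuous_tsum_log {ι : Type*} {κ : ι → ℂ} (hκ : ∀ n, 0 < (κ n).re)
    (hs : Summable fun n => (‖κ n‖ ^ 2)⁻¹) :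
    Continuous fun x : ℝ => ∑' n, Complex.log (1 + (x / κ n : ℂ) ^ 2) := by
  have hR (R : ℝ) : ContinuousOn (fun x : ℝ => ∑' n, Complex.log (1 + (x / κ n : ℂ) ^ 2))
      (Icc (-R) R) := by
    choose b hb using fun n => isCompact_Icc.exists_bound_of_continuousOn
      ((continuous_log_one_add_div_sq (hκ n)).continuousOn (s := Icc (-R) R))
    classical
    have hev : ∀ᶠ n in cofinite, R ^ 2 * (‖κ n‖ ^ 2)⁻¹ < 1 / 2 :=
      (hs.mul_left (R ^ 2)).tendsto_cofinite_zero.eventually (Iio_mem_nhds (by norm_num))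
    -- All but finitely many terms obey the summable bound on log(1 + z) for small z; the exceptions
    -- use compactness.
    refine continuousOn_tsum (u := fun n => if R ^ 2 * (‖κ n‖ ^ 2)⁻¹ < 1 / 2 then
      3 / 2 * (R ^ 2 * (‖κ n‖ ^ 2)⁻¹) else b n)
      (fun n => (continuous_log_one_add_div_sq (hκ n)).continuousOn) ?_ ?_
    · refine ((hs.mul_left (R ^ 2)).mul_left (3 / 2)).congr_cofinite ?_
      filter_upwards [hev] with n hn
      rw [if_pos hn]
    · intro n x hx
      split_ifs with h
      · have hx2 : x ^ 2 ≤ R ^ 2 := sq_le_sq' hx.1 hx.2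
        have hz : ‖(x / κ n : ℂ) ^ 2‖ ≤ R ^ 2 * (‖κ n‖ ^ 2)⁻¹ := by
          rw [norm_pow, norm_div, div_pow, Complex.norm_real, Real.norm_eq_abs, sq_abs,
            div_eq_mul_inv]
          gcongr
        exact (Complex.norm_log_one_add_half_le_self (hz.trans h.le)).trans (by gcongr)
      · exact hb n x hx
  rw [continuous_iff_continuousAt]
  intro x
  refine (hR (|x| + 1)).continuousAt (Icc_mem_nhds ?_ ?_)
  · linarith [neg_abs_le x]
  · linarith [le_abs_self x]

lemma exp_tsum_log {ι : Type*} {κ : ι → ℂ} (hκ : ∀ n, 0 < (κ n).re)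
    (hs : Summable fun n => (‖κ n‖ ^ 2)⁻¹) (x : ℝ) :
    Complex.exp (∑' n, Complex.log (1 + (x / κ n : ℂ) ^ 2)) = ∏' n, (1 + (x / κ n : ℂ) ^ 2) :=
  Complex.cexp_tsum_eq_tprod
    (fun n => Complex.slitPlane_ne_zero (one_add_div_sq_mem_slitPlane (hκ n) x))
    (Complex.summable_log_one_add_of_summable (summable_div_sq hs x))

/-- The product determines the sum of logarithms only modulo 2πi. Continuity of that sum in x
prevents jumps, so a limit of the product gives a limit of the sum. -/
theorem tendsto_sq_mul_tsum_of_prod_asymptotics {ι : Type*} [Countable ι] {κ : ι → ℂ}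
    (hκ : ∀ n, 0 < (κ n).re) (hs : Summable fun n => ‖κ n‖ ^ (-(3 / 2) : ℝ))
    (hs2 : Summable fun n => (‖κ n‖ ^ 2)⁻¹) {A a c : ℂ} (hc : c ≠ 0)
    (hP : Tendsto (fun x : ℝ => (∏' n, (1 + (x / κ n : ℂ) ^ 2)) *
      Complex.exp (-A * x + a / 2 * Complex.log (1 + (x : ℂ) ^ 2))) atTop (𝓝 c)) :
    Tendsto (fun y : ℝ => (y : ℂ) ^ 2 * ∑' n, 1 / (κ n + y) ^ 2 - A / Real.pi * y) atTop
      (𝓝 (-a / 2)) := by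
  set g : ℝ → ℂ := fun x => ∑' n, Complex.log (1 + (x / κ n : ℂ) ^ 2) +
    (-A * x + a / 2 * Complex.log (1 + (x : ℂ) ^ 2)) with hg
  have hgc : Continuous g := by
    have h1 : Continuous fun x : ℝ => Complex.log (1 + (x : ℂ) ^ 2) := by
      simpa using continuous_log_one_add_div_sq (κ := 1) (by simp)
    exact (continuous_tsum_log hκ hs2).add ((by fun_prop : Continuous fun x : ℝ => -A * (x : ℂ)).add
      (h1.const_mul _))
  obtain ⟨b, hb⟩ := exists_tendsto_of_tendsto_exp hgc hc (by
    simpa only [hg, Complex.exp_add _ (-A * _ + _), exp_tsum_log hκ hs2] using hP)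
  refine tendsto_sq_mul_tsum_of_log_asymptotics hκ hs (c := b) (e := fun x => g x - b)
    (hgc.sub continuous_const).continuousOn (by simpa using hb.sub_const b) fun x _ => ?_
  simp only [hg]
  ring

/-! ### Lower bounds and weighted averages along a branch -/

/-- No cancellation occurs in the right half plane: ‖z + y‖ dominates both ‖z‖ and y. -/
lemma half_add_le_norm_add {z : ℂ} (hz : 0 ≤ z.re) {y : ℝ} (hy : 0 ≤ y) :
    (‖z‖ + y) / 2 ≤ ‖z + y‖ := by
  have h1 : ‖z + y‖ ^ 2 = ‖z‖ ^ 2 + 2 * y * z.re + y ^ 2 := by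
    simp only [Complex.sq_norm, Complex.normSq_apply, Complex.add_re, Complex.add_im,
      Complex.ofReal_re, Complex.ofReal_im]
    ring
  have h2 : ‖z‖ ≤ ‖z + y‖ := by
    apply le_of_sq_le_sq _ (norm_nonneg _)
    nlinarith [mul_nonneg hy hz]
  have h3 : y ≤ ‖z + y‖ := by
    apply le_of_sq_le_sq _ (norm_nonneg _)
    nlinarith [mul_nonneg hy hz, sq_nonneg ‖z‖]
  linarith

lemma exists_pos_le_of_tendsto {u : ℕ → ℝ} (hu : ∀ m, 0 < u m) {l : ℝ} (hl : 0 < l)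
    (h : Tendsto u atTop (𝓝 l)) : ∃ c, 0 < c ∧ ∀ m, c ≤ u m := by
  obtain ⟨B, hB⟩ := (h.inv₀ hl.ne').bddAbove_range
  have hB' : ∀ m, (u m)⁻¹ ≤ B := fun m => hB ⟨m, rfl⟩
  have hB0 : 0 < B := (inv_pos.2 (hu 0)).trans_le (hB' 0)
  exact ⟨B⁻¹, inv_pos.2 hB0, fun m => inv_le_of_inv_le₀ (hu m) (hB' m)⟩

lemma summable_rpow_neg_of_le {κ : ℕ → ℂ} {c : ℝ} (hc : 0 < c)
    (h : ∀ m : ℕ, c * (m + 1) ≤ ‖κ m‖) {p : ℝ} (hp : 1 < p) :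
    Summable fun m => ‖κ m‖ ^ (-p) := by
  have h1 : Summable fun m : ℕ => ((m + 1 : ℕ) : ℝ) ^ (-p) :=
    (summable_nat_add_iff 1).2 (Real.summable_nat_rpow.2 (by linarith))
  refine Summable.of_nonneg_of_le (fun m => by positivity) (fun m => ?_) (h1.mul_left (c ^ (-p)))
  rw [← Real.mul_rpow hc.le (by positivity)]
  push_cast
  exact Real.rpow_le_rpow_of_nonpos (by positivity) (h m) (by linarith)

lemma summable_inv_sq_of_le {κ : ℕ → ℂ} {c : ℝ} (hc : 0 < c)
    (h : ∀ m : ℕ, c * (m + 1) ≤ ‖κ m‖) : Summable fun m => (‖κ m‖ ^ 2)⁻¹ := by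
  refine (summable_rpow_neg_of_le hc h (p := 2) (by norm_num)).congr fun m => ?_
  rw [Real.rpow_neg (norm_nonneg _)]
  norm_num

lemma summable_one_div_add_sq {κ : ℕ → ℂ} (hκ : ∀ m, 0 < (κ m).re) {c : ℝ} (hc : 0 < c)
    (h : ∀ m : ℕ, c * (m + 1) ≤ ‖κ m‖) {y : ℝ} (hy : 0 < y) :
    Summable fun m => 1 / (κ m + y) ^ 2 := by
  refine Summable.of_norm_bounded ((summable_inv_sq_of_le hc h).mul_left 4) fun m => ?_
  have h1 := half_add_le_norm_add (hκ m).le hy.le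
  have h2 : 0 < ‖κ m‖ := lt_of_lt_of_le (by positivity) (h m)
  rw [norm_div, norm_one, norm_pow, ← div_eq_mul_inv,
    div_le_div_iff₀ (by nlinarith) (by positivity)]
  nlinarith

/-- Telescoping against y/(m + y), whose value at m = 0 is 1: the weights have total mass at most 1,
uniformly in y. -/
lemma sum_range_div_sq_le {y : ℝ} (hy : 0 < y) (n : ℕ) :
    ∑ m ∈ Finset.range n, y / ((m : ℝ) + 1 + y) ^ 2 ≤ 1 := by
  have h : ∀ m : ℕ, y / ((m : ℝ) + 1 + y) ^ 2 ≤ y / (m + y) - y / ((m + 1 : ℕ) + y) := by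
    intro m
    push_cast
    rw [div_sub_div _ _ (by positivity) (by positivity), div_le_div_iff₀ (by positivity)
      (by positivity)]
    have : 0 ≤ y * ((m : ℝ) + 1 + y) := by positivity
    nlinarith
  refine (Finset.sum_le_sum fun m _ => h m).trans ?_
  rw [Finset.sum_range_sub' fun m : ℕ => y / ((m : ℝ) + y)]
  have : 0 ≤ y / ((n : ℝ) + y) := by positivity
  simp only [Nat.cast_zero, zero_add, div_self hy.ne']
  linarith

lemma summable_div_add_sq {y : ℝ} (hy : 0 < y) :
    Summable fun m : ℕ => y / ((m : ℝ) + 1 + y) ^ 2 :=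
  summable_of_sum_range_le (fun m => by positivity) (sum_range_div_sq_le hy)

lemma exists_abs_le_of_tendsto {ε : ℕ → ℝ} (h : Tendsto ε atTop (𝓝 0)) :
    ∃ B, 0 ≤ B ∧ ∀ m, |ε m| ≤ B := by
  obtain ⟨B, hB⟩ := h.abs.bddAbove_range
  have hB' : ∀ m, |ε m| ≤ B := fun m => hB ⟨m, rfl⟩
  exact ⟨B, (abs_nonneg _).trans (hB' 0), hB'⟩

lemma summable_mul_div_add_sq {ε : ℕ → ℝ} (h : Tendsto ε atTop (𝓝 0)) {y : ℝ} (hy : 0 < y) :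
    Summable fun m : ℕ => ε m * (y / ((m : ℝ) + 1 + y) ^ 2) := by
  obtain ⟨B, hB0, hB⟩ := exists_abs_le_of_tendsto h
  refine Summable.of_norm_bounded ((summable_div_add_sq hy).mul_left B) fun m => ?_
  rw [norm_mul, Real.norm_eq_abs, Real.norm_of_nonneg (by positivity)]
  gcongr
  exact hB m

/-- A Toeplitz-type lemma: the averages of a null sequence with the weights
`y / (m + 1 + y) ^ 2` tend to zero as `y → ∞`. -/
lemma tendsto_tsum_mul_div_add_sq {ε : ℕ → ℝ} (h0 : ∀ m, 0 ≤ ε m) (h : Tendsto ε atTop (𝓝 0)) :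
    Tendsto (fun y : ℝ => ∑' m : ℕ, ε m * (y / ((m : ℝ) + 1 + y) ^ 2)) atTop (𝓝 0) := by
  obtain ⟨B, hB0, hB⟩ := exists_abs_le_of_tendsto h
  rw [Metric.tendsto_nhds]
  intro η hη
  obtain ⟨N, hN⟩ := eventually_atTop.1 (h.eventually (Iic_mem_nhds (half_pos hη)))
  have hlim : Tendsto (fun y : ℝ => N * B / y) atTop (𝓝 0) :=
    tendsto_const_nhds.div_atTop tendsto_id
  filter_upwards [eventually_gt_atTop 0, hlim.eventually (Iio_mem_nhds (half_pos hη))] with y hy hy2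
  have hbound : ∑' m : ℕ, ε m * (y / ((m : ℝ) + 1 + y) ^ 2) ≤ η / 2 + N * B / y := by
    refine Real.tsum_le_of_sum_range_le (fun m => mul_nonneg (h0 m) (by positivity)) fun n => ?_
    -- Past N the sequence is at most η/2 and the mass is at most 1; before N there are finitely
    -- many terms, each with weight at most 1/y.
    have hterm : ∀ m ∈ Finset.range n, ε m * (y / ((m : ℝ) + 1 + y) ^ 2) ≤
        η / 2 * (y / ((m : ℝ) + 1 + y) ^ 2) + if m < N then B / y else 0 := by
      intro m _
      split_ifs with hm
      · have h1 : y / ((m : ℝ) + 1 + y) ^ 2 ≤ 1 / y := by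
          rw [div_le_div_iff₀ (by positivity) hy]
          nlinarith [(Nat.cast_nonneg m : (0 : ℝ) ≤ m), mul_nonneg (Nat.cast_nonneg m : (0 : ℝ) ≤ m) hy.le]
        have h2 : ε m * (y / ((m : ℝ) + 1 + y) ^ 2) ≤ B * (1 / y) := by
          gcongr
          exact (le_abs_self _).trans (hB m)
        have h3 : 0 ≤ η / 2 * (y / ((m : ℝ) + 1 + y) ^ 2) := by positivity
        rw [mul_one_div] at h2
        linarith
      · rw [add_zero]
        gcongr
        exact hN m (not_lt.1 hm)
    refine (Finset.sum_le_sum hterm).trans ?_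
    rw [Finset.sum_add_distrib, ← Finset.mul_sum, ← Finset.sum_filter, Finset.sum_const,
      nsmul_eq_mul]
    have h1 := sum_range_div_sq_le hy n
    have h2 : (((Finset.range n).filter (· < N)).card : ℝ) ≤ N := by
      have : ((Finset.range n).filter (· < N)) ⊆ Finset.range N := fun m hm => by
        simp only [Finset.mem_filter, Finset.mem_range] at hm ⊢
        exact hm.2
      simpa using Finset.card_le_card this
    have h3 : (((Finset.range n).filter (· < N)).card : ℝ) * (B / y) ≤ N * (B / y) := by gcongr
    rw [mul_div_assoc]
    nlinarith
  have hnn : 0 ≤ ∑' m : ℕ, ε m * (y / ((m : ℝ) + 1 + y) ^ 2) :=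
    tsum_nonneg fun m => mul_nonneg (h0 m) (by positivity)
  rw [Real.dist_eq, sub_zero, abs_of_nonneg hnn]
  have : N * B / y < η / 2 := hy2
  linarith

lemma tendsto_one_div_nat_add_one : Tendsto (fun m : ℕ => 1 / ((m : ℝ) + 1)) atTop (𝓝 0) :=
  tendsto_one_div_add_atTop_nhds_zero_nat

/-! ### Contribution of a single branch -/

/-- Large y absorbs the shift ζ. Only Re κ₀ ≥ 0 is available, since a branch may run asymptotically
along the real frequency direction. -/
lemma le_norm_linear {κ₀ ζ : ℂ} (hκ₀ : 0 ≤ κ₀.re) {s y : ℝ} (hs : 0 ≤ s)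
    (hy : 4 * ‖κ₀ * ζ‖ ≤ y) : min ‖κ₀‖ 1 / 4 * (s + y) ≤ ‖κ₀ * (s + ζ) + y‖ := by
  have hy0 : 0 ≤ y := le_trans (by positivity) hy
  have h1 := half_add_le_norm_add (z := κ₀ * s) (by simpa using mul_nonneg hκ₀ hs) hy0
  rw [norm_mul, Complex.norm_real, Real.norm_of_nonneg hs] at h1
  have h2 : ‖κ₀ * s + y‖ - ‖κ₀ * ζ‖ ≤ ‖κ₀ * (s + ζ) + y‖ := by
    have := norm_sub_le (κ₀ * (s + ζ) + y) (κ₀ * ζ)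
    rw [show κ₀ * (s + ζ) + y - κ₀ * ζ = κ₀ * s + y by ring] at this
    linarith
  have h3 : min ‖κ₀‖ 1 * s ≤ ‖κ₀‖ * s := by gcongr; exact min_le_left _ _
  have h4 : min ‖κ₀‖ 1 * y ≤ 1 * y := by gcongr; exact min_le_right _ _
  have h5 : 0 ≤ min ‖κ₀‖ 1 * s := by positivity
  linarith

lemma add_one_div_div_le {a s y : ℝ} (ha : 0 ≤ a) (hs : 1 ≤ s) (hy : 0 < y) :
    (a + 1 / s) / (s + y) ≤ a / s + 1 / s := by
  have h1 : 0 ≤ 1 / s := by positivity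
  rw [add_div]
  refine add_le_add ?_ (div_le_self h1 (by linarith))
  exact div_le_div_of_nonneg_left ha (by linarith) (by linarith)

lemma mul_div_linear_eq {κ₀ ζ y : ℂ} (h0 : κ₀ ≠ 0) (hy : κ₀ * ζ + y ≠ 0) :
    ζ * (y / (κ₀ * ζ + y)) = 1 / κ₀ * y - y * (y / κ₀ * (1 / (κ₀ * ζ + y))) := by
  obtain ⟨q, rfl⟩ : ∃ q, y = q - κ₀ * ζ := ⟨κ₀ * ζ + y, by ring⟩
  rw [add_sub_cancel] at hy ⊢
  field_simp
  ring

/-- Comparison of a branch with an arithmetic progression, whose sum telescopes. -/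
lemma exists_norm_sub_le {κ : ℕ → ℂ} (hκ : ∀ m, 0 < (κ m).re) {c : ℝ} (hc : 0 < c)
    (h : ∀ m : ℕ, c * (m + 1) ≤ ‖κ m‖) {κ₀ ξ : ℂ} (h0 : κ₀ ≠ 0) (h0re : 0 ≤ κ₀.re) {D : ℝ}
    (hD0 : 0 ≤ D) (hD : ∀ m : ℕ, ‖κ m - κ₀ * (m + 1 + ξ)‖ ≤ D * (m + 1)) :
    ∃ C Y : ℝ, 0 ≤ C ∧ 0 < Y ∧ ∀ y : ℝ, Y ≤ y → ∀ m : ℕ,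
      ‖1 / (κ m + y) ^ 2 -
        (1 / κ₀ * (1 / (κ₀ * (m + (1 / 2 + ξ)) + y)) -
          1 / κ₀ * (1 / (κ₀ * ((m + 1 : ℕ) + (1 / 2 + ξ)) + y)))‖ ≤
      C * ((‖κ m - κ₀ * (m + 1 + ξ)‖ + 1 / ((m : ℝ) + 1)) / ((m : ℝ) + 1 + y) ^ 3) := by
  set c₁ := min (min ‖κ₀‖ 1 / 4) (min c 1 / 2) with hc₁
  have hn0 : 0 < ‖κ₀‖ := norm_pos_iff.2 h0
  have hc₁0 : 0 < c₁ := lt_min (by positivity) (by positivity)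
  set C₁ := 2 * (‖κ₀‖ * (1 + ‖ξ‖) + 1) + D + ‖κ₀‖ ^ 2 / 4 with hC₁
  refine ⟨C₁ / c₁ ^ 4, 4 * (‖κ₀‖ * (‖ξ‖ + 1 / 2)) + 1, by positivity, by positivity, ?_⟩
  intro y hy m
  have hy0 : 0 < y := lt_of_lt_of_le (by positivity) hy
  set s : ℝ := (m : ℝ) + 1 with hs
  have hs1 : 1 ≤ s := by rw [hs]; linarith [(Nat.cast_nonneg m : (0 : ℝ) ≤ m)]
  have hms : (m : ℂ) + 1 = (s : ℂ) := by rw [hs]; push_cast; ring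
  set r := κ m - κ₀ * (m + 1 + ξ) with hr
  -- With natural indices the model point is κ₀(m + 1 + ξ), and p and q lie half a step on either
  -- side of it, shifted by y. Centring gives pq = z² − κ₀²/4, with no term linear in z, so the
  -- telescoping terms 1/(pq) are accurate enough for the constant order.
  set p := κ₀ * (m + (1 / 2 + ξ)) + y with hp
  set q := κ₀ * ((m + 1 : ℕ) + (1 / 2 + ξ)) + y with hq
  set u := κ m + y with hu
  set z := κ₀ * (s + ξ) + y with hz
  have hh : ‖(1 / 2 : ℂ)‖ = 1 / 2 := by norm_num
  have hp1 : c₁ * (s + y) ≤ ‖p‖ := by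
    have e : p = κ₀ * (s + (ξ - 1 / 2)) + y := by rw [hp, ← hms]; ring
    rw [e]
    refine le_trans ?_ (le_norm_linear h0re (by linarith) ?_)
    · gcongr; exact min_le_left _ _
    · rw [norm_mul]
      have := norm_sub_le ξ (1 / 2)
      rw [hh] at this
      nlinarith
  have hq1 : c₁ * (s + y) ≤ ‖q‖ := by
    have e : q = κ₀ * (s + (ξ + 1 / 2)) + y := by rw [hq, ← hms]; push_cast; ring
    rw [e]
    refine le_trans ?_ (le_norm_linear h0re (by linarith) ?_)
    · gcongr; exact min_le_left _ _
    · rw [norm_mul]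
      have := norm_add_le ξ (1 / 2)
      rw [hh] at this
      nlinarith
  have hu1 : c₁ * (s + y) ≤ ‖u‖ := by
    refine le_trans ?_ (half_add_le_norm_add (hκ m).le hy0.le)
    have h1 : c₁ ≤ min c 1 / 2 := min_le_right _ _
    have h2 : min c 1 * s ≤ c * s := by gcongr; exact min_le_left _ _
    have h3 : min c 1 * y ≤ 1 * y := by gcongr; exact min_le_right _ _
    have h4 := h m
    have h5 : c₁ * (s + y) ≤ min c 1 / 2 * (s + y) := by gcongr
    linarith
  have hpos : 0 < c₁ * (s + y) := by positivity
  have hp0 : p ≠ 0 := norm_pos_iff.1 (hpos.trans_le hp1)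
  have hq0 : q ≠ 0 := norm_pos_iff.1 (hpos.trans_le hq1)
  have hu0 : u ≠ 0 := norm_pos_iff.1 (hpos.trans_le hu1)
  have hqp : q - p = κ₀ := by rw [hq, hp]; push_cast; ring
  have hpq : p * q = z ^ 2 - κ₀ ^ 2 / 4 := by
    rw [hp, hq, hz, ← hms]; push_cast; ring
  have huz : u = z + r := by rw [hu, hz, hr, ← hms]; ring
  have e1 : 1 / u ^ 2 - (1 / κ₀ * (1 / p) - 1 / κ₀ * (1 / q)) =
      (-(r * (2 * z + r)) - κ₀ ^ 2 / 4) / (u ^ 2 * (p * q)) := by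
    have : 1 / κ₀ * (1 / p) - 1 / κ₀ * (1 / q) = 1 / (p * q) := by
      field_simp
      rw [hqp]
    rw [this, div_sub_div _ _ (pow_ne_zero 2 hu0) (mul_ne_zero hp0 hq0)]
    congr 1
    rw [one_mul, mul_one, hpq, huz]
    ring
  rw [e1, norm_div]
  have hzle : ‖z‖ ≤ (‖κ₀‖ * (1 + ‖ξ‖) + 1) * (s + y) := by
    have h1 : ‖z‖ ≤ ‖κ₀‖ * (s + ‖ξ‖) + y := by
      refine (norm_add_le _ _).trans ?_
      rw [norm_mul, Complex.norm_real, Real.norm_of_nonneg hy0.le]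
      gcongr
      refine (norm_add_le _ _).trans ?_
      rw [Complex.norm_real, Real.norm_of_nonneg (by linarith)]
    have h2 : ‖κ₀‖ * ‖ξ‖ * 1 ≤ ‖κ₀‖ * ‖ξ‖ * (s + y) :=
      mul_le_mul_of_nonneg_left (by linarith) (by positivity)
    have h3 : 0 ≤ ‖κ₀‖ * y := by positivity
    nlinarith
  have hrle : ‖r‖ ≤ D * (s + y) := (hD m).trans (mul_le_mul_of_nonneg_left (by linarith) hD0)
  have hnum : ‖-(r * (2 * z + r)) - κ₀ ^ 2 / 4‖ ≤ C₁ * (‖r‖ * (s + y) + 1) := by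
    have h1 : ‖-(r * (2 * z + r)) - κ₀ ^ 2 / 4‖ ≤ ‖r‖ * (2 * ‖z‖ + ‖r‖) + ‖κ₀‖ ^ 2 / 4 := by
      refine (norm_sub_le _ _).trans ?_
      rw [norm_neg, norm_mul, norm_div, norm_pow]
      have : ‖(4 : ℂ)‖ = 4 := by norm_num
      rw [this]
      gcongr
      refine (norm_add_le _ _).trans ?_
      rw [norm_mul]
      norm_num
    have h2 : ‖r‖ * (2 * ‖z‖ + ‖r‖) ≤
        ‖r‖ * ((2 * (‖κ₀‖ * (1 + ‖ξ‖) + 1) + D) * (s + y)) := by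
      gcongr
      linarith
    have h3 : 0 ≤ ‖κ₀‖ ^ 2 / 4 * (‖r‖ * (s + y)) := by positivity
    have h4 : 0 ≤ 2 * (‖κ₀‖ * (1 + ‖ξ‖) + 1) + D := by positivity
    rw [hC₁]
    nlinarith
  have hden : (c₁ * (s + y)) ^ 4 ≤ ‖u ^ 2 * (p * q)‖ := by
    rw [norm_mul, norm_pow, norm_mul]
    calc (c₁ * (s + y)) ^ 4 = (c₁ * (s + y)) ^ 2 * ((c₁ * (s + y)) * (c₁ * (s + y))) := by ring
      _ ≤ _ := by gcongr
  have hC₁0 : 0 ≤ C₁ := by positivity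
  calc _ ≤ C₁ * (‖r‖ * (s + y) + 1) / (c₁ * (s + y)) ^ 4 := by gcongr
    _ = C₁ / c₁ ^ 4 * ((‖r‖ + 1 / (s + y)) / (s + y) ^ 3) := by
        have : s + y ≠ 0 := by positivity
        field_simp
    _ ≤ _ := by gcongr; linarith

lemma hasSum_sub_succ {b : ℕ → ℂ} (hb : Tendsto b atTop (𝓝 0))
    (hs : Summable fun m => b m - b (m + 1)) : HasSum (fun m => b m - b (m + 1)) (b 0) := by
  rw [hs.hasSum_iff_tendsto_nat]
  simp only [Finset.sum_range_sub']
  simpa using hb.const_sub (b 0)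

lemma tendsto_one_div_linear {κ₀ ζ : ℂ} (h0 : κ₀ ≠ 0) (h0re : 0 ≤ κ₀.re) {y : ℝ}
    (hy : 4 * ‖κ₀ * ζ‖ ≤ y) :
    Tendsto (fun m : ℕ => 1 / κ₀ * (1 / (κ₀ * (m + ζ) + y))) atTop (𝓝 0) := by
  have hn0 : 0 < ‖κ₀‖ := norm_pos_iff.2 h0
  have h1 : Tendsto (fun m : ℕ => ‖κ₀ * (m + ζ) + y‖) atTop atTop := by
    refine tendsto_atTop_mono (fun m => le_norm_linear h0re (Nat.cast_nonneg m) hy) ?_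
    exact (tendsto_atTop_add_const_right _ _ tendsto_natCast_atTop_atTop).const_mul_atTop
      (by positivity)
  have h2 : Tendsto (fun m : ℕ => 1 / (κ₀ * (m + ζ) + y)) atTop (𝓝 0) := by
    rw [tendsto_zero_iff_norm_tendsto_zero]
    simpa [Function.comp_def] using tendsto_inv_atTop_zero.comp h1
  simpa using h2.const_mul (1 / κ₀)

/-- The sum of `1 / (κ m + y) ^ 2` over a branch, up to an explicit error. -/
lemma exists_norm_tsum_sub_le {κ : ℕ → ℂ} (hκ : ∀ m, 0 < (κ m).re) {c : ℝ} (hc : 0 < c)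
    (h : ∀ m : ℕ, c * (m + 1) ≤ ‖κ m‖) {κ₀ ξ : ℂ} (h0 : κ₀ ≠ 0) (h0re : 0 ≤ κ₀.re)
    (hr : Tendsto (fun m : ℕ => ‖κ m - κ₀ * (m + 1 + ξ)‖ / ((m : ℝ) + 1)) atTop (𝓝 0)) :
    ∃ C Y : ℝ, 0 < Y ∧ ∀ y : ℝ, Y ≤ y →
      ‖y * ∑' m, 1 / (κ m + y) ^ 2 - y / κ₀ * (1 / (κ₀ * (1 / 2 + ξ) + y))‖ ≤
      C * ∑' m : ℕ, (‖κ m - κ₀ * (m + 1 + ξ)‖ + 1 / ((m : ℝ) + 1)) / ((m : ℝ) + 1 + y) *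
        (y / ((m : ℝ) + 1 + y) ^ 2) ∧
      Summable fun m : ℕ => (‖κ m - κ₀ * (m + 1 + ξ)‖ + 1 / ((m : ℝ) + 1)) /
        ((m : ℝ) + 1 + y) * (y / ((m : ℝ) + 1 + y) ^ 2) := by
  obtain ⟨D, hD0, hD⟩ := exists_abs_le_of_tendsto hr
  have hD' : ∀ m : ℕ, ‖κ m - κ₀ * (m + 1 + ξ)‖ ≤ D * (m + 1) := fun m => by
    have := (le_abs_self _).trans (hD m)
    rwa [div_le_iff₀ (by positivity)] at this
  obtain ⟨C, Y, hC, hY, hle⟩ := exists_norm_sub_le hκ hc h h0 h0re hD0 hD'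
  refine ⟨C, max Y (4 * ‖κ₀ * (1 / 2 + ξ)‖), lt_max_of_lt_left hY, fun y hy => ?_⟩
  have hyY := (le_max_left _ _).trans hy
  have hy0 : 0 < y := hY.trans_le hyY
  have hs : Summable fun m : ℕ => (‖κ m - κ₀ * (m + 1 + ξ)‖ + 1 / ((m : ℝ) + 1)) /
        ((m : ℝ) + 1 + y) * (y / ((m : ℝ) + 1 + y) ^ 2) := by
    have hlim : Tendsto (fun m : ℕ => ‖κ m - κ₀ * (m + 1 + ξ)‖ / ((m : ℝ) + 1) +
        1 / ((m : ℝ) + 1)) atTop (𝓝 0) := by simpa using hr.add tendsto_one_div_nat_add_one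
    refine Summable.of_nonneg_of_le (fun m => by positivity) (fun m => ?_)
      (summable_mul_div_add_sq hlim hy0)
    exact mul_le_mul_of_nonneg_right (add_one_div_div_le (norm_nonneg _)
      (by linarith [(Nat.cast_nonneg m : (0 : ℝ) ≤ m)]) hy0) (by positivity)
  refine ⟨?_, hs⟩
  set b : ℕ → ℂ := fun m => 1 / κ₀ * (1 / (κ₀ * (m + (1 / 2 + ξ)) + y)) with hb
  have hterm : ∀ m : ℕ, ‖y * (1 / (κ m + y) ^ 2 - (b m - b (m + 1)))‖ ≤
      C * ((‖κ m - κ₀ * (m + 1 + ξ)‖ + 1 / ((m : ℝ) + 1)) / ((m : ℝ) + 1 + y) *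
        (y / ((m : ℝ) + 1 + y) ^ 2)) := by
    intro m
    rw [norm_mul, Complex.norm_real, Real.norm_of_nonneg hy0.le]
    calc _ ≤ y * (C * ((‖κ m - κ₀ * (m + 1 + ξ)‖ + 1 / ((m : ℝ) + 1)) /
          ((m : ℝ) + 1 + y) ^ 3)) := by
          gcongr
          exact hle y hyY m
      _ = _ := by
          have : (m : ℝ) + 1 + y ≠ 0 := by positivity
          field_simp
  have hsd : Summable fun m : ℕ => y * (1 / (κ m + y) ^ 2 - (b m - b (m + 1))) :=
    Summable.of_norm_bounded (hs.mul_left C) hterm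
  have hy0' : (y : ℂ) ≠ 0 := by exact_mod_cast hy0.ne'
  -- Summability of the telescoping differences follows from that of the branch and of the error.
  have hsu := summable_one_div_add_sq hκ hc h hy0
  have hsb : Summable fun m => b m - b (m + 1) := by
    have := hsu.sub ((summable_mul_left_iff hy0').1 hsd)
    simpa using this
  have hbt := (hasSum_sub_succ (tendsto_one_div_linear h0 h0re ((le_max_right _ _).trans hy))
    hsb).tsum_eq
  have e : y * ∑' m, 1 / (κ m + y) ^ 2 - y / κ₀ * (1 / (κ₀ * (1 / 2 + ξ) + y)) =
      ∑' m : ℕ, y * (1 / (κ m + y) ^ 2 - (b m - b (m + 1))) := by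
    rw [tsum_mul_left, hsu.tsum_sub hsb, hbt]
    simp only [Nat.cast_zero, zero_add]
    ring
  rw [e, ← tsum_mul_left]
  exact tsum_of_norm_bounded (hs.mul_left C).hasSum hterm

lemma tendsto_div_linear (κ₀ ζ : ℂ) :
    Tendsto (fun y : ℝ => (y : ℂ) / (κ₀ * ζ + y)) atTop (𝓝 1) := by
  have h1 : Tendsto (fun y : ℝ => κ₀ * ζ * ((y⁻¹ : ℝ) : ℂ) + 1) atTop (𝓝 (κ₀ * ζ * 0 + 1)) :=
    (((Complex.continuous_ofReal.tendsto _).comp tendsto_inv_atTop_zero).const_mul _).add_const _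
  rw [mul_zero, zero_add] at h1
  have h2 := h1.inv₀ one_ne_zero
  rw [inv_one] at h2
  refine h2.congr' ?_
  filter_upwards [eventually_gt_atTop 0] with y hy
  have hy0 : (y : ℂ) ≠ 0 := by exact_mod_cast hy.ne'
  have : κ₀ * ζ * ((y⁻¹ : ℝ) : ℂ) + 1 = (κ₀ * ζ + y) / y := by
    push_cast
    field_simp
  rw [this, inv_div]

/-- A linear branch contributes `1 / κ₀` to leading order. -/
theorem tendsto_mul_tsum_of_linear {κ : ℕ → ℂ} (hκ : ∀ m, 0 < (κ m).re) {c : ℝ} (hc : 0 < c)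
    (h : ∀ m : ℕ, c * (m + 1) ≤ ‖κ m‖) {κ₀ : ℂ} (h0 : κ₀ ≠ 0) (h0re : 0 ≤ κ₀.re)
    (hr : Tendsto (fun m : ℕ => ‖κ m - κ₀ * (m + 1)‖ / ((m : ℝ) + 1)) atTop (𝓝 0)) :
    Tendsto (fun y : ℝ => (y : ℂ) * ∑' m, 1 / (κ m + y) ^ 2) atTop (𝓝 (1 / κ₀)) := by
  -- At leading order a shift is absorbed into the o(m) remainder, so ξ = 0 suffices.
  obtain ⟨C, Y, hY, hle⟩ := exists_norm_tsum_sub_le hκ hc h (ξ := 0) h0 h0re (by simpa using hr)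
  simp only [add_zero] at hle
  have hlim : Tendsto (fun m : ℕ => ‖κ m - κ₀ * (m + 1)‖ / ((m : ℝ) + 1) +
      1 / ((m : ℝ) + 1)) atTop (𝓝 0) := by simpa using hr.add tendsto_one_div_nat_add_one
  have ht := (tendsto_tsum_mul_div_add_sq (fun m => by positivity) hlim).const_mul |C|
  rw [mul_zero] at ht
  have hd : Tendsto (fun y : ℝ => (y : ℂ) * ∑' m, 1 / (κ m + y) ^ 2 -
      y / κ₀ * (1 / (κ₀ * (1 / 2) + y))) atTop (𝓝 0) := by
    refine squeeze_zero_norm' ?_ ht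
    filter_upwards [eventually_ge_atTop Y] with y hy
    have hy0 : 0 < y := hY.trans_le hy
    obtain ⟨h1, h2⟩ := hle y hy
    refine h1.trans ((mul_le_mul_of_nonneg_right (le_abs_self C)
      (tsum_nonneg fun m => by positivity)).trans ?_)
    gcongr ?_ * ?_
    refine h2.tsum_le_tsum (fun m => ?_) (summable_mul_div_add_sq hlim hy0)
    exact mul_le_mul_of_nonneg_right (add_one_div_div_le (norm_nonneg _)
      (by linarith [(Nat.cast_nonneg m : (0 : ℝ) ≤ m)]) hy0) (by positivity)
  have h3 := hd.add ((tendsto_div_linear κ₀ (1 / 2)).const_mul (1 / κ₀))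
  rw [zero_add, mul_one] at h3
  refine h3.congr fun y => ?_
  ring

/-- Subleading contribution of a linear branch with shift `ξ`. -/
theorem tendsto_sq_mul_tsum_of_linear {κ : ℕ → ℂ} (hκ : ∀ m, 0 < (κ m).re) {c : ℝ} (hc : 0 < c)
    (h : ∀ m : ℕ, c * (m + 1) ≤ ‖κ m‖) {κ₀ ξ : ℂ} (h0 : κ₀ ≠ 0) (h0re : 0 ≤ κ₀.re)
    (hr : Tendsto (fun m : ℕ => ‖κ m - κ₀ * (m + 1 + ξ)‖) atTop (𝓝 0)) :
    Tendsto (fun y : ℝ => (y : ℂ) ^ 2 * ∑' m, 1 / (κ m + y) ^ 2 - 1 / κ₀ * y) atTop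
      (𝓝 (-(1 / 2 + ξ))) := by
  have hr' : Tendsto (fun m : ℕ => ‖κ m - κ₀ * (m + 1 + ξ)‖ / ((m : ℝ) + 1)) atTop (𝓝 0) := by
    have := hr.mul tendsto_one_div_nat_add_one
    simpa [div_eq_mul_inv] using this
  obtain ⟨C, Y, hY, hle⟩ := exists_norm_tsum_sub_le hκ hc h (ξ := ξ) h0 h0re hr'
  have hlim : Tendsto (fun m : ℕ => ‖κ m - κ₀ * (m + 1 + ξ)‖ +
      1 / ((m : ℝ) + 1)) atTop (𝓝 0) := by simpa using hr.add tendsto_one_div_nat_add_one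
  have ht := (tendsto_tsum_mul_div_add_sq (fun m => by positivity) hlim).const_mul |C|
  rw [mul_zero] at ht
  -- The extra factor y is absorbed by the denominator m + 1 + y of the error; the price is that the
  -- remainder itself must tend to 0, not just its ratio to m.
  have hd : Tendsto (fun y : ℝ => (y : ℂ) * ((y : ℂ) * ∑' m, 1 / (κ m + y) ^ 2 -
      y / κ₀ * (1 / (κ₀ * (1 / 2 + ξ) + y)))) atTop (𝓝 0) := by
    refine squeeze_zero_norm' ?_ ht
    filter_upwards [eventually_ge_atTop Y] with y hy
    have hy0 : 0 < y := hY.trans_le hy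
    obtain ⟨h1, h2⟩ := hle y hy
    rw [norm_mul, Complex.norm_real, Real.norm_of_nonneg hy0.le]
    refine (mul_le_mul_of_nonneg_left (h1.trans (mul_le_mul_of_nonneg_right (le_abs_self C)
      (tsum_nonneg fun m => by positivity))) hy0.le).trans ?_
    rw [mul_left_comm]
    gcongr ?_ * ?_
    rw [← tsum_mul_left]
    refine (h2.mul_left y).tsum_le_tsum (fun m => ?_) (summable_mul_div_add_sq hlim hy0)
    rw [← mul_assoc]
    gcongr
    rw [mul_div_left_comm]
    refine mul_le_of_le_one_right (by positivity) ?_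
    rw [div_le_one (by positivity)]
    linarith [(Nat.cast_nonneg m : (0 : ℝ) ≤ m)]
  have h3 := hd.sub ((tendsto_div_linear κ₀ (1 / 2 + ξ)).const_mul (1 / 2 + ξ))
  rw [zero_sub, mul_one] at h3
  refine h3.congr' ?_
  have hne : ∀ᶠ y : ℝ in atTop, κ₀ * (1 / 2 + ξ) + y ≠ 0 := by
    filter_upwards [eventually_gt_atTop ‖κ₀ * (1 / 2 + ξ)‖] with y hy hc
    have : (y : ℂ) = -(κ₀ * (1 / 2 + ξ)) := by linear_combination hc
    have h4 := congrArg norm this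
    rw [norm_neg, Complex.norm_real, Real.norm_of_nonneg ((norm_nonneg _).trans hy.le)] at h4
    exact hy.ne' h4
  filter_upwards [hne] with y hy
  rw [mul_div_linear_eq h0 hy]
  ring

/-- A branch growing faster than linearly does not contribute to leading order. -/
theorem tendsto_mul_tsum_of_superlinear {κ : ℕ → ℂ} (hκ : ∀ m, 0 < (κ m).re) {c α : ℝ}
    (hc : 0 < c) (hα : 1 < α) (h : ∀ m : ℕ, c * ((m : ℝ) + 1) ^ α ≤ ‖κ m‖) :
    Tendsto (fun y : ℝ => (y : ℂ) * ∑' m, 1 / (κ m + y) ^ 2) atTop (𝓝 0) := by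
  have hs : Summable fun m : ℕ => 2 * c⁻¹ * ((m + 1 : ℕ) : ℝ) ^ (-α) :=
    ((summable_nat_add_iff 1).2 (Real.summable_nat_rpow.2 (by linarith))).mul_left _
  have hpos : ∀ m, 0 < ‖κ m‖ := fun m => lt_of_lt_of_le (by positivity) (h m)
  have hterm : ∀ (m : ℕ) (y : ℝ), 0 < y → ‖(y : ℂ) * (1 / (κ m + y) ^ 2)‖ ≤
      4 * y / (‖κ m‖ + y) ^ 2 := by
    intro m y hy
    have h1 := half_add_le_norm_add (hκ m).le hy.le
    have h2 := hpos m
    rw [norm_mul, Complex.norm_real, Real.norm_of_nonneg hy.le, norm_div, norm_one, norm_pow,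
      mul_one_div, div_le_div_iff₀ (by nlinarith) (by positivity)]
    nlinarith [mul_le_mul h1 h1 (by positivity) (norm_nonneg _)]
  simp only [← tsum_mul_left]
  have := tendsto_tsum_of_dominated_convergence (𝓕 := atTop)
    (f := fun (y : ℝ) (m : ℕ) => (y : ℂ) * (1 / (κ m + y) ^ 2)) (g := fun _ => 0) hs ?_ ?_
  · simpa using this
  · intro m
    have hl : Tendsto (fun y : ℝ => 4 / y) atTop (𝓝 0) := tendsto_const_nhds.div_atTop tendsto_id
    refine squeeze_zero_norm' ?_ hl
    filter_upwards [eventually_gt_atTop 0] with y hy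
    refine (hterm m y hy).trans ?_
    have h2 := hpos m
    rw [div_le_div_iff₀ (by positivity) hy]
    nlinarith [mul_pos h2 hy]
  · filter_upwards [eventually_gt_atTop 0] with y hy m
    refine (hterm m y hy).trans ?_
    have h2 := hpos m
    -- A bound uniform in y, from (‖κ‖ + y)² ≥ 2‖κ‖y; it is summable in m because α > 1.
    have h3 : 4 * y / (‖κ m‖ + y) ^ 2 ≤ 2 * ‖κ m‖⁻¹ := by
      rw [← div_eq_mul_inv, div_le_div_iff₀ (by positivity) h2]
      nlinarith [mul_pos h2 hy]
    refine h3.trans ?_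
    rw [mul_assoc, Real.rpow_neg (by positivity), ← mul_inv]
    push_cast
    gcongr
    exact h m

/-! ### From the correlator to asymptotics of the spectral sum -/

lemma IsRetardedCorrelator.im_neg {G : ℂ → ℂ} (hG : IsRetardedCorrelator G) {z : ℂ}
    (hz : z ∈ spectrumPoles G) : z.im < 0 := by
  by_contra! h
  exact absurd (hG.retarded z h).meromorphicOrderAt_nonneg (not_le.2 hz)

lemma tendsto_sinh_mul_exp {b : ℝ} (hb : 0 < b) :
    Tendsto (fun x : ℝ => Complex.sinh (b * x / 2) * Complex.exp (-(b / 2 : ℂ) * x)) atTop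
      (𝓝 (1 / 2)) := by
  have h1 : Tendsto (fun x : ℝ => (1 - Real.exp (-(b * x))) / 2) atTop (𝓝 ((1 - 0) / 2)) :=
    ((Real.tendsto_exp_neg_atTop_nhds_zero.comp
      (tendsto_id.const_mul_atTop hb)).const_sub 1).div_const 2
  have h2 := (Complex.continuous_ofReal.tendsto _).comp h1
  simp only [sub_zero, Complex.ofReal_div, Complex.ofReal_one, Complex.ofReal_ofNat] at h2
  refine h2.congr fun x => ?_
  have e1 : Complex.exp (b * x / 2) * Complex.exp (-(b / 2 : ℂ) * x) = 1 := by
    rw [← Complex.exp_add, ← Complex.exp_zero]; congr 1; ring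
  have e2 : Complex.exp (-(b * x / 2)) * Complex.exp (-(b / 2 : ℂ) * x) =
      Complex.exp (-(b * x)) := by
    rw [← Complex.exp_add]; congr 1; ring
  simp only [Function.comp_def, Complex.sinh]
  push_cast
  linear_combination (-1 / 2) * e1 + (1 / 2) * e2

lemma tendsto_exp_log_div_rpow (a : ℝ) :
    Tendsto (fun x : ℝ => Complex.exp ((a : ℂ) / 2 * Complex.log (1 + (x : ℂ) ^ 2)) /
      ((x ^ a : ℝ) : ℂ)) atTop (𝓝 1) := by
  have h1 : Tendsto (fun x : ℝ => (1 + (x ^ 2)⁻¹) ^ (a / 2)) atTop (𝓝 ((1 + 0) ^ (a / 2))) :=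
    ((tendsto_inv_atTop_zero.comp (tendsto_pow_atTop (two_ne_zero))).const_add 1).rpow_const
      (Or.inl (by norm_num))
  have h2 := (Complex.continuous_ofReal.tendsto _).comp h1
  simp only [add_zero, Real.one_rpow, Complex.ofReal_one] at h2
  refine h2.congr' ?_
  filter_upwards [eventually_gt_atTop 0] with x hx
  have h3 : (1 + (x : ℂ) ^ 2) = ((1 + x ^ 2 : ℝ) : ℂ) := by push_cast; rfl
  have h4 : x ^ a = (x ^ 2) ^ (a / 2) := by
    rw [← Real.rpow_natCast, ← Real.rpow_mul hx.le]
    congr 1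
    push_cast
    ring
  have h5 : 0 < 1 + x ^ 2 := by positivity
  have h6 : Complex.exp ((a : ℂ) / 2 * Complex.log (1 + (x : ℂ) ^ 2)) =
      (((1 + x ^ 2) ^ (a / 2) : ℝ) : ℂ) := by
    rw [h3, ← Complex.ofReal_log h5.le, Real.rpow_def_of_pos h5]
    push_cast
    congr 1
    ring
  rw [h6, h4, ← Complex.ofReal_div, ← Real.div_rpow h5.le (by positivity)]
  simp only [Function.comp_def]
  congr 2
  field_simp
  ring

/-- The thermal product formula and the short-distance scaling, turned into asymptotics of the sum
of `1 / (i ωₙ + y) ^ 2` over the spectrum. -/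
theorem tendsto_of_thermalProductFormula {ι : Type*} [Countable ι] {β μ a : ℝ} (hβ : 0 < β)
    (hμ : 0 < μ) {G : ℂ → ℂ} (hG : IsRetardedCorrelator G) {w : ι → ℂ}
    (hw : EnumeratesSpectrum G w) (hTPF : ThermalProductFormula β μ G w)
    (hOPE : SpectralDensityScales G a)
    (hs : Summable fun n => ‖Complex.I * w n‖ ^ (-(3 / 2) : ℝ))
    (hs2 : Summable fun n => (‖Complex.I * w n‖ ^ 2)⁻¹) :
    Tendsto (fun y : ℝ => (y : ℂ) ^ 2 * ∑' n, 1 / (Complex.I * w n + y) ^ 2 -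
      (β / 2 : ℂ) / Real.pi * y) atTop (𝓝 (-(a : ℂ) / 2)) := by
  have hκ : ∀ n, 0 < (Complex.I * w n).re := fun n => by
    have := hG.im_neg (hw.2 ▸ mem_range_self n)
    simpa using this
  obtain ⟨C, hC, hρ⟩ := hOPE
  have hC' : (C : ℂ) ≠ 0 := by exact_mod_cast hC
  have hμ' : (μ : ℂ) ≠ 0 := by exact_mod_cast hμ.ne'
  have hreal : ∀ x : ℝ, (x : ℂ) ∉ spectrumPoles G := fun x hx => by
    have := hG.im_neg hx
    simp at this
  -- The rotation κₙ = iωₙ moves the spectrum to the right half plane.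
  have hfac : ∀ (x : ℝ) (n : ι), 1 - ((x : ℂ) / w n) ^ 2 = 1 + (x / (Complex.I * w n)) ^ 2 := by
    intro x n
    rw [div_pow, div_pow, mul_pow, Complex.I_sq, neg_one_mul, div_neg, sub_eq_add_neg]
  have hform : ∀ x : ℝ, spectralDensity G x = μ * Complex.sinh (β * x / 2) /
      ∏' n, (1 + ((x : ℂ) / (Complex.I * w n)) ^ 2) := by
    intro x
    have := (hTPF x (hreal x) (by simpa using hreal (-x))).2
    simpa only [hfac] using this
  have hne : ∀ᶠ x : ℝ in atTop, ((C * x ^ a : ℝ) : ℂ) ≠ 0 := by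
    filter_upwards [eventually_gt_atTop 0] with x hx
    have := Real.rpow_pos_of_pos hx a
    exact_mod_cast mul_ne_zero hC this.ne'
  have h1 := ((isEquivalent_iff_tendsto_one hne).1 hρ).inv₀ one_ne_zero
  rw [inv_one] at h1
  -- The limit constant is μ/(2C): μ/2 from sinh and 1/C from ρ.
  refine tendsto_sq_mul_tsum_of_prod_asymptotics hκ hs hs2
    (c := μ * (1 / 2) * (1 * (C : ℂ)⁻¹) * 1) (by simp [hμ', hC']) ?_
  refine ((((tendsto_sinh_mul_exp hβ).const_mul (μ : ℂ)).mul (h1.mul_const (C : ℂ)⁻¹)).mul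
    (tendsto_exp_log_div_rpow a)).congr' ?_
  filter_upwards [eventually_gt_atTop 0] with x hx
  have hx' : ((x ^ a : ℝ) : ℂ) ≠ 0 := by exact_mod_cast (Real.rpow_pos_of_pos hx a).ne'
  have hP : ∏' n, (1 + ((x : ℂ) / (Complex.I * w n)) ^ 2) ≠ 0 := by
    rw [← exp_tsum_log hκ hs2 x]
    exact Complex.exp_ne_zero _
  have hsinh : Complex.sinh (β * x / 2) ≠ 0 := by
    have : (β * x / 2 : ℂ) = ((β * x / 2 : ℝ) : ℂ) := by push_cast; rfl
    rw [this, ← Complex.ofReal_sinh]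
    exact_mod_cast (Real.sinh_pos_iff.2 (by positivity)).ne'
  rw [Complex.exp_add]
  simp only [Pi.div_apply, hform, Complex.ofReal_mul]
  field_simp

/-! ### Decomposition into branches -/

lemma tendsto_succPNat : Tendsto Nat.succPNat atTop atTop := by
  refine tendsto_atTop.2 fun b => ?_
  filter_upwards [eventually_ge_atTop (b : ℕ)] with n hn
  rw [← PNat.coe_le_coe, Nat.succPNat_coe]
  omega

lemma summable_fin_prod_pnat {M : ℕ} {f : Fin M × ℕ+ → ℝ} (h0 : ∀ n, 0 ≤ f n)
    (h : ∀ j, Summable fun m : ℕ => f (j, m.succPNat)) : Summable f := by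
  rw [summable_prod_of_nonneg h0]
  exact ⟨fun j => Equiv.pnatEquivNat.symm.summable_iff.1 (h j), Summable.of_finite⟩

lemma tsum_fin_prod_pnat {M : ℕ} {f : Fin M × ℕ+ → ℂ} (h : Summable f) :
    ∑' n, f n = ∑ j, ∑' m : ℕ, f (j, m.succPNat) := by
  rw [h.tsum_prod, tsum_fintype]
  exact Finset.sum_congr rfl fun j _ => (Equiv.pnatEquivNat.symm.tsum_eq fun m => f (j, m)).symm

/-- The spectral asymptotics for a spectrum arranged into branches of at least linear growth. -/
theorem tendsto_sum_branches {β μ a : ℝ} (hβ : 0 < β) (hμ : 0 < μ) {G : ℂ → ℂ}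
    (hG : IsRetardedCorrelator G) {M : ℕ} {w : Fin M × ℕ+ → ℂ} (hw : EnumeratesSpectrum G w)
    (hTPF : ThermalProductFormula β μ G w) (hOPE : SpectralDensityScales G a)
    (hc : ∀ j, ∃ c : ℝ, 0 < c ∧ ∀ m : ℕ, c * ((m : ℝ) + 1) ≤ ‖Complex.I * w (j, m.succPNat)‖) :
    Tendsto (fun y : ℝ => (y : ℂ) ^ 2 *
      (∑ j, ∑' m : ℕ, 1 / (Complex.I * w (j, m.succPNat) + y) ^ 2) -
      (β / 2 : ℂ) / Real.pi * y) atTop (𝓝 (-(a : ℂ) / 2)) := by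
  choose c hc0 hc using hc
  have hs2 : Summable fun n => (‖Complex.I * w n‖ ^ 2)⁻¹ :=
    summable_fin_prod_pnat (fun n => by positivity) fun j => summable_inv_sq_of_le (hc0 j) (hc j)
  have hs : Summable fun n => ‖Complex.I * w n‖ ^ (-(3 / 2) : ℝ) :=
    summable_fin_prod_pnat (fun n => by positivity) fun j =>
      summable_rpow_neg_of_le (hc0 j) (hc j) (by norm_num)
  have hκ : ∀ n, 0 < (Complex.I * w n).re := fun n => by
    have := hG.im_neg (hw.2 ▸ mem_range_self n)
    simpa using this
  refine (tendsto_of_thermalProductFormula hβ hμ hG hw hTPF hOPE hs hs2).congr' ?_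
  filter_upwards [eventually_gt_atTop 0] with y hy
  rw [tsum_fin_prod_pnat]
  refine Summable.of_norm_bounded (hs2.mul_left 4) fun n => ?_
  have h1 := half_add_le_norm_add (hκ n).le hy.le
  have h2 : 0 < ‖Complex.I * w n‖ := norm_pos_iff.2 fun h => by
    have := hκ n
    rw [h] at this
    simp at this
  rw [norm_div, norm_one, norm_pow, ← div_eq_mul_inv,
    div_le_div_iff₀ (by nlinarith) (by positivity)]
  nlinarith

/-- κ₀ is the limit of κ m/(m + 1), so it lies in the closed half plane. The lower bound holds from
the first index on because no κ m vanishes. -/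
lemma linear_branch_bounds {κ : ℕ → ℂ} (hκ : ∀ m, 0 < (κ m).re) {κ₀ : ℂ} (h0 : κ₀ ≠ 0)
    (h : Tendsto (fun m : ℕ => ‖κ m - κ₀ * (m + 1)‖ / ((m : ℝ) + 1)) atTop (𝓝 0)) :
    0 ≤ κ₀.re ∧ ∃ c : ℝ, 0 < c ∧ ∀ m : ℕ, c * ((m : ℝ) + 1) ≤ ‖κ m‖ := by
  have hpos : ∀ m : ℕ, (0 : ℝ) < (m : ℝ) + 1 := fun m => by positivity
  have h1 : Tendsto (fun m : ℕ => κ m / (((m : ℝ) + 1 : ℝ) : ℂ)) atTop (𝓝 κ₀) := by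
    rw [tendsto_iff_norm_sub_tendsto_zero]
    refine h.congr fun m => ?_
    have hm : (((m : ℝ) + 1 : ℝ) : ℂ) ≠ 0 := by exact_mod_cast (hpos m).ne'
    have e : κ m / (((m : ℝ) + 1 : ℝ) : ℂ) - κ₀ =
        (κ m - κ₀ * (m + 1)) / (((m : ℝ) + 1 : ℝ) : ℂ) := by
      rw [sub_div, eq_comm]
      congr 1
      rw [div_eq_iff hm]
      push_cast
      rfl
    rw [e, norm_div, Complex.norm_real, Real.norm_of_nonneg (hpos m).le]
  constructor
  · refine ge_of_tendsto ((Complex.continuous_re.tendsto _).comp h1)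
      (Eventually.of_forall fun m => ?_)
    simp only [Function.comp_def, Complex.div_ofReal_re]
    exact div_nonneg (hκ m).le (hpos m).le
  · have hκn : ∀ m, 0 < ‖κ m‖ := fun m => norm_pos_iff.2 fun hm => by
      have := hκ m
      rw [hm] at this
      simp at this
    have h2 : Tendsto (fun m : ℕ => ‖κ m‖ / ((m : ℝ) + 1)) atTop (𝓝 ‖κ₀‖) := by
      refine h1.norm.congr fun m => ?_
      rw [norm_div, Complex.norm_real, Real.norm_of_nonneg (hpos m).le]
    obtain ⟨c, hc, hle⟩ := exists_pos_le_of_tendsto (fun m => div_pos (hκn m) (hpos m))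
      (norm_pos_iff.2 h0) h2
    exact ⟨c, hc, fun m => (le_div_iff₀ (hpos m)).1 (hle m)⟩

lemma eq_zero_of_tendsto_mul {b l : ℂ} (h : Tendsto (fun y : ℝ => b * (y : ℂ)) atTop (𝓝 l)) :
    b = 0 := by
  have h1 := h.mul ((Complex.continuous_ofReal.tendsto _).comp (tendsto_inv_atTop_zero (𝕜 := ℝ)))
  simp only [Complex.ofReal_zero, mul_zero] at h1
  refine tendsto_nhds_unique (tendsto_const_nhds.congr' ?_) h1
  filter_upwards [eventually_gt_atTop 0] with y hy
  have hy0 : (y : ℂ) ≠ 0 := by exact_mod_cast hy.ne'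
  simp [hy0]

lemma neg_I_mul_sum_one_div {M : ℕ} (s : Finset (Fin M)) (δ : Fin M → ℂ) :
    -Complex.I * ∑ j ∈ s, 1 / δ j = ∑ j ∈ s, 1 / (Complex.I * δ j) := by
  rw [Finset.mul_sum]
  refine Finset.sum_congr rfl fun j _ => ?_
  rw [one_div, one_div, mul_inv, Complex.inv_I]

/-- The rate m^(-ε) enters only through the remainder tending to 0. -/
lemma IsChristmasTree.tendsto_norm {M : ℕ} {w : Fin M × ℕ+ → ℂ} {δ ξ : Fin M → ℂ}
    (h : IsChristmasTree w δ ξ) (j : Fin M) :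
    Tendsto (fun m : ℕ => ‖Complex.I * w (j, m.succPNat) -
      Complex.I * δ j * (m + 1 + ξ j)‖) atTop (𝓝 0) := by
  obtain ⟨-, ε, hε, hO⟩ := h
  have h1 : Tendsto (fun m : ℕ => ((m.succPNat : ℕ+) : ℝ) ^ (-ε)) atTop (𝓝 0) := by
    refine (tendsto_rpow_neg_atTop hε).comp ?_
    simpa using tendsto_atTop_add_const_right _ _ tendsto_natCast_atTop_atTop
  have h2 := (((hO j).comp_tendsto tendsto_succPNat).trans_tendsto h1).norm
  rw [norm_zero] at h2
  refine h2.congr fun m => ?_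
  rw [mul_assoc, ← mul_sub, norm_mul, Complex.norm_I, one_mul]
  simp

lemma IsScalingTree.tendsto_div {M : ℕ} {w : Fin M × ℕ+ → ℂ} {α : Fin M → ℝ} {δ : Fin M → ℂ}
    (h : IsScalingTree w α δ) (j : Fin M) :
    Tendsto (fun m : ℕ => w (j, m.succPNat) / ((((m : ℝ) + 1) ^ α j : ℝ) : ℂ)) atTop
      (𝓝 (δ j)) := by
  obtain ⟨h0, h1⟩ := h j
  have hpos : ∀ m : ℕ+, (((m : ℝ) ^ α j : ℝ) : ℂ) ≠ 0 := fun m => by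
    have : (0 : ℝ) < m := by exact_mod_cast m.pos
    exact_mod_cast (Real.rpow_pos_of_pos this _).ne'
  have h2 := (((isEquivalent_iff_tendsto_one (Eventually.of_forall fun m =>
    mul_ne_zero h0 (hpos m))).1 h1).comp tendsto_succPNat).const_mul (δ j)
  rw [mul_one] at h2
  refine h2.congr fun m => ?_
  have h3 := hpos m.succPNat
  simp only [Function.comp_def, Pi.div_apply]
  have e : ((m.succPNat : ℕ) : ℝ) = (m : ℝ) + 1 := by simp
  rw [e] at h3 ⊢
  field_simp

/-! ### Matching the two expansions -/

theorem mainTheorem7 (β μ Δ : ℝ) (hβ : 0 < β) (hμ : 0 < μ) (d : ℕ)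
    (G : ℂ → ℂ) (hG : IsRetardedCorrelator G)
    (M : ℕ) (w : Fin M × ℕ+ → ℂ) (hw : EnumeratesSpectrum G w)
    (hTPF : ThermalProductFormula β μ G w)
    (hOPE : SpectralDensityScales G (2 * Δ - d)) :
    (∀ δ ξ : Fin M → ℂ, IsChristmasTree w δ ξ →
      -Complex.I * ∑ j, 1 / δ j = ((β / (2 * Real.pi) : ℝ) : ℂ) ∧
      ∑ j, (1 + 2 * ξ j) = ((2 * Δ - d : ℝ) : ℂ)) ∧
    (∀ (α : Fin M → ℝ) (δ : Fin M → ℂ), (∀ j, 1 ≤ α j) → IsScalingTree w α δ →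
      -Complex.I * ∑ j with α j = 1, 1 / δ j = ((β / (2 * Real.pi) : ℝ) : ℂ)) := by
  have hκ : ∀ j (m : ℕ), 0 < (Complex.I * w (j, m.succPNat)).re := fun j m => by
    have := hG.im_neg (hw.2 ▸ mem_range_self (j, m.succPNat))
    simpa using this
  have hβc : ((β / (2 * Real.pi) : ℝ) : ℂ) = (β / 2 : ℂ) / Real.pi := by
    push_cast
    rw [div_div]
  constructor
  · intro δ ξ hT
    have h0 : ∀ j, Complex.I * δ j ≠ 0 := fun j => mul_ne_zero Complex.I_ne_zero (hT.1 j)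
    have hr := fun j => hT.tendsto_norm j
    have hb : ∀ j, 0 ≤ (Complex.I * δ j).re ∧ ∃ c : ℝ, 0 < c ∧ ∀ m : ℕ,
        c * ((m : ℝ) + 1) ≤ ‖Complex.I * w (j, m.succPNat)‖ := by
      intro j
      refine linear_branch_bounds (hκ j) (h0 j) ?_
      have h1 : Tendsto (fun m : ℕ => (‖Complex.I * w (j, m.succPNat) -
          Complex.I * δ j * (m + 1 + ξ j)‖ + ‖Complex.I * δ j * ξ j‖) * (1 / ((m : ℝ) + 1)))
          atTop (𝓝 ((0 + ‖Complex.I * δ j * ξ j‖) * 0)) :=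
        ((hr j).add_const _).mul tendsto_one_div_nat_add_one
      rw [mul_zero] at h1
      refine squeeze_zero (fun m => by positivity) (fun m => ?_) h1
      rw [mul_one_div]
      gcongr
      refine le_trans (le_of_eq ?_) (norm_add_le _ _)
      congr 1
      ring
    have hsum := tendsto_sum_branches hβ hμ hG hw hTPF hOPE fun j => (hb j).2
    choose hre c hc0 hc using hb
    have hbr := tendsto_finsetSum Finset.univ fun j (_ : j ∈ Finset.univ) =>
      tendsto_sq_mul_tsum_of_linear (hκ j) (hc0 j) (hc j) (h0 j) (hre j) (hr j)
    have hdiff := hsum.sub hbr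
    -- The two convergent expressions differ by a multiple of y, so the multiple is zero. Once the
    -- linear terms agree, uniqueness of limits equates the constants.
    have hcoef : ∑ j, 1 / (Complex.I * δ j) - (β / 2 : ℂ) / Real.pi = 0 := by
      refine eq_zero_of_tendsto_mul (hdiff.congr fun y => ?_)
      rw [Finset.sum_sub_distrib, ← Finset.mul_sum, ← Finset.sum_mul]
      ring
    have hcoef' := sub_eq_zero.1 hcoef
    refine ⟨by rw [neg_I_mul_sum_one_div, hβc, hcoef'], ?_⟩
    have hlim := tendsto_nhds_unique hsum (hbr.congr fun y => by
      rw [Finset.sum_sub_distrib, ← Finset.mul_sum, ← Finset.sum_mul, hcoef'])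
    have e : ∑ j, (1 + 2 * ξ j) = -2 * ∑ j, -(1 / 2 + ξ j) := by
      rw [Finset.mul_sum]
      exact Finset.sum_congr rfl fun j _ => by ring
    rw [e, ← hlim]
    ring
  · intro α δ hα hT
    have h0 : ∀ j, Complex.I * δ j ≠ 0 := fun j => mul_ne_zero Complex.I_ne_zero (hT j).1
    have hpos : ∀ m : ℕ, (0 : ℝ) < (m : ℝ) + 1 := fun m => by positivity
    have hb : ∀ j, ∃ c : ℝ, 0 < c ∧ ∀ m : ℕ,
        c * ((m : ℝ) + 1) ^ α j ≤ ‖Complex.I * w (j, m.succPNat)‖ := by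
      intro j
      have h1 : Tendsto (fun m : ℕ => ‖Complex.I * w (j, m.succPNat)‖ / ((m : ℝ) + 1) ^ α j) atTop
          (𝓝 ‖δ j‖) := by
        refine (hT.tendsto_div j).norm.congr fun m => ?_
        rw [norm_div, Complex.norm_real, Real.norm_of_nonneg (by positivity), norm_mul,
          Complex.norm_I, one_mul]
      obtain ⟨c, hc, hle⟩ := exists_pos_le_of_tendsto (fun m => div_pos
        (norm_pos_iff.2 fun h => by have := hκ j m; rw [h] at this; simp at this)
        (Real.rpow_pos_of_pos (hpos m) _)) (norm_pos_iff.2 (hT j).1) h1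
      exact ⟨c, hc, fun m => (le_div_iff₀ (Real.rpow_pos_of_pos (hpos m) _)).1 (hle m)⟩
    choose c hc0 hc using hb
    have hc1 : ∀ j (m : ℕ), c j * ((m : ℝ) + 1) ≤ ‖Complex.I * w (j, m.succPNat)‖ := by
      intro j m
      refine le_trans ?_ (hc j m)
      have := hc0 j
      gcongr
      exact Real.self_le_rpow_of_one_le (by linarith [(Nat.cast_nonneg m : (0 : ℝ) ≤ m)]) (hα j)
    have hsum := tendsto_sum_branches hβ hμ hG hw hTPF hOPE fun j => ⟨c j, hc0 j, hc1 j⟩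
    have hbr : ∀ j, Tendsto (fun y : ℝ =>
        (y : ℂ) * ∑' m : ℕ, 1 / (Complex.I * w (j, m.succPNat) + y) ^ 2) atTop
        (𝓝 (if α j = 1 then 1 / (Complex.I * δ j) else 0)) := by
      intro j
      split_ifs with h
      · have h1 : Tendsto (fun m : ℕ => ‖Complex.I * w (j, m.succPNat) -
            Complex.I * δ j * (m + 1)‖ / ((m : ℝ) + 1)) atTop (𝓝 0) := by
          have h2 := hT.tendsto_div j
          simp only [h, Real.rpow_one] at h2
          rw [tendsto_iff_norm_sub_tendsto_zero] at h2
          refine h2.congr fun m => ?_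
          have hm : (((m : ℝ) + 1 : ℝ) : ℂ) ≠ 0 := by exact_mod_cast (hpos m).ne'
          have e : w (j, m.succPNat) / (((m : ℝ) + 1 : ℝ) : ℂ) - δ j =
              (w (j, m.succPNat) - δ j * (((m : ℝ) + 1 : ℝ) : ℂ)) / (((m : ℝ) + 1 : ℝ) : ℂ) := by
            field_simp
          rw [e, norm_div, Complex.norm_real, Real.norm_of_nonneg (hpos m).le, mul_assoc,
            ← mul_sub, norm_mul, Complex.norm_I, one_mul]
          push_cast
          rfl
        exact tendsto_mul_tsum_of_linear (hκ j) (hc0 j) (hc1 j) (h0 j)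
          (linear_branch_bounds (hκ j) (h0 j) h1).1 h1
      · exact tendsto_mul_tsum_of_superlinear (hκ j) (hc0 j)
          (lt_of_le_of_ne (hα j) (Ne.symm h)) (hc j)
    have hbr' := tendsto_finsetSum Finset.univ fun j (_ : j ∈ Finset.univ) => hbr j
    -- Dividing the spectral asymptotics by y leaves only the coefficient β/(2π).
    have h3 := (hsum.mul ((Complex.continuous_ofReal.tendsto _).comp
      (tendsto_inv_atTop_zero (𝕜 := ℝ)))).add_const ((β / 2 : ℂ) / Real.pi)
    simp only [Complex.ofReal_zero, mul_zero, zero_add] at h3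
    rw [neg_I_mul_sum_one_div, hβc, Finset.sum_filter]
    refine tendsto_nhds_unique hbr' (h3.congr' ?_)
    filter_upwards [eventually_gt_atTop 0] with y hy
    have hy0 : (y : ℂ) ≠ 0 := by exact_mod_cast hy.ne'
    rw [← Finset.mul_sum]
    simp only [Function.comp_def, Complex.ofReal_inv]
    field_simp
    ring
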